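/- Let $n\ge 0$, let $\xi_0,\dots,\xi_n$ be independent real-valued random variables with probability density functions $f_0,\dots,f_n$, and let $G(z)=\xi_0+\xi_1z+\dots+\xi_nz^n$. Let $\mu=\sum_{z\in\mathbb C:\,G(z)=0}\delta_z$ be the empirical measure counting the zeros of $G$, and let $\mathbb C_+=\{z\in\mathbb C:\operatorname{Im}z>0\}$. For $k,l\ge 0$ with $k+2l\le n$, a function $\rho_{k,l}:\mathbb R^k\times\mathbb C_+^l\to[0,\infty)$ is called a mixed $(k,l)$-correlation function of the zeros of $G$ if for all mutually disjoint Borel sets $B_1,\dots,B_k\subset\mathbb R$ and $B_{k+1},\dots,B_{k+l}\subset\mathbb C_+$ $$\mathbb E\Big[\prod_{i=1}^{k+l}\mu(B_i)\Big]=\int_{B_1}\dots\int_{B_{k+l}}\rho_{k,l}(\mathbf x,\mathbf z)\,d\mathbf x\,d\mathbf z,$$ where both sides are well defined and finite, and $d\mathbf z$ is Lebesgue measure on $\mathbb C^l=\mathbb R^{2l}$. For $0\le m\le n$ and points $w=(w_1,\dots,w_m)\in\mathbb C^m$ all of whose elementary symmetric polynomials $\sigma_i(w)$ are real (with $\sigma_0=1$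 and $\sigma_i=0$ for $i<0$ or $i>m$), put $$\rho_m(w)=\prod_{1\le i<j\le m}|w_i-w_j|\int_{\mathbb R^{n-m+1}}\prod_{i=0}^n f_i\Big(\sum_{j=0}^{n-m}(-1)^{m-i+j}\sigma_{m-i+j}(w)\,t_j\Big)\prod_{i=1}^m\Big|\sum_{j=0}^{n-m}t_jw_i^j\Big|\,dt_0\dots dt_{n-m}.$$ Then, for all $k,l\ge 0$ with $k+2l\le n$, the mixed $(k,l)$-correlation function of the zeros of $G$ is $$\rho_{k,l}(\mathbf x,\mathbf z)=2^l\,\rho_{k+2l}(\mathbf x,\mathbf z,\bar{\mathbf z}),\qquad(\mathbf x,\mathbf z)\in\mathbb R^k\times\mathbb C_+^l .$$ That is: the integral defining $\rho_{k+2l}(\mathbf x,\mathbf z,\bar{\mathbf z})$ is finite for almost every $(\mathbf x,\mathbf z)$; the function $(\mathbf x,\mathbf z)\mapsto 2^l\rho_{k+2l}(\mathbf x,\mathbf z,\bar{\mathbf z})$ (given the value $0$ on the null set where that integral diverges) is a mixed $(k,l)$-correlation function of the zeros of $G$; and every mixed $(k,l)$-correlation function of the zeros of $G$ coincides with it at Lebesgue-almost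 every point of $\mathbb R^k\times\mathbb C_+^l$. -/

import Mathlib

open MeasureTheory ProbabilityTheory

noncomputable section

/-- The polynomial function `G(z) = a₀ + a₁ z + ⋯ + aₙ zⁿ` with real coefficients `a₀, …, aₙ`. -/
def polyFun {n : ℕ} (a : Fin (n + 1) → ℝ) (z : ℂ) : ℂ :=
  ∑ i : Fin (n + 1), (a i : ℂ) * z ^ (i : ℕ)

/-- The empirical measure `μ = ∑_{z : G(z) = 0} δ_z` counting the zeros of `G`. -/
def zeroMeasure {n : ℕ} (a : Fin (n + 1) → ℝ) : Measure ℂ :=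
  Measure.sum fun z : {z : ℂ // polyFun a z = 0} => Measure.dirac (z : ℂ)

/-- The points `(x, z)` of `ℝᵏ × ℂˡ` that lie in `ℝᵏ × ℂ₊ˡ`. -/
def upperConfig (k l : ℕ) : Set ((Fin k → ℝ) × (Fin l → ℂ)) :=
  {p | ∀ j, 0 < (p.2 j).im}

/-- `r` is a mixed `(k,l)`-correlation function of the zeros of the random polynomial with
coefficients `ξ₀, …, ξₙ`: it is nonnegative on `ℝᵏ × ℂ₊ˡ`, and for mutually disjoint Borel sets
`B₁, …, B_k ⊆ ℝ` and `C₁, …, C_l ⊆ ℂ₊` the expectation of `∏ μ(B_i) ∏ μ(C_j)` is the integral of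
`r` over `B₁ × ⋯ × B_k × C₁ × ⋯ × C_l` (both integrals being well defined and finite).
Only the values of `r` on `ℝᵏ × ℂ₊ˡ` matter. -/
structure IsMixedCorrelation {Ω : Type*} [MeasurableSpace Ω] (P : Measure Ω) {n : ℕ}
    (ξ : Fin (n + 1) → Ω → ℝ) (k l : ℕ) (r : (Fin k → ℝ) → (Fin l → ℂ) → ℝ) : Prop where
  nonneg : ∀ p ∈ upperConfig k l, 0 ≤ r p.1 p.2
  correlation : ∀ (B : Fin k → Set ℝ) (C : Fin l → Set ℂ),
    (∀ i, MeasurableSet (B i)) → (∀ j, MeasurableSet (C j)) →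
    (∀ j, C j ⊆ {z : ℂ | 0 < z.im}) →
    Pairwise (fun i i' => Disjoint (B i) (B i')) →
    Pairwise (fun j j' => Disjoint (C j) (C j')) →
    Integrable (fun ω =>
      (∏ i, (zeroMeasure fun q => ξ q ω).real (Complex.ofReal '' B i)) *
        ∏ j, (zeroMeasure fun q => ξ q ω).real (C j)) P ∧
    IntegrableOn (fun p : (Fin k → ℝ) × (Fin l → ℂ) => r p.1 p.2)
      (Set.univ.pi B ×ˢ Set.univ.pi C) volume ∧
    ∫ ω, (∏ i, (zeroMeasure fun q => ξ q ω).real (Complex.ofReal '' B i)) *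
        ∏ j, (zeroMeasure fun q => ξ q ω).real (C j) ∂P =
      ∫ p in Set.univ.pi B ×ˢ Set.univ.pi C, r p.1 p.2

/-- The elementary symmetric polynomial `σ_p(w₁, …, w_m)`, with `σ₀ = 1` and `σ_p = 0` when
`p < 0` or `p > m` (in the latter case the sum is empty). -/
def elemSymm {m : ℕ} (w : Fin m → ℂ) (p : ℤ) : ℂ :=
  if p < 0 then 0
  else ∑ s ∈ Finset.powersetCard p.toNat (Finset.univ : Finset (Fin m)), ∏ j ∈ s, w j

/-- The absolute value of the Vandermonde determinant, `∏_{i < j} |w_i - w_j|`. -/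
def absVandermonde {m : ℕ} (w : Fin m → ℂ) : ℝ :=
  ∏ i, ∏ j ∈ Finset.Ioi i, ‖w i - w j‖

/-- The number `∑_{j=0}^{n-m} (-1)^{m-i+j} σ_{m-i+j}(w) t_j`. It is only used at points `w` all of
whose elementary symmetric polynomials are real. -/
def rhoCoeff (n : ℕ) {m : ℕ} (w : Fin m → ℂ) (t : Fin (n - m + 1) → ℝ) (i : Fin (n + 1)) : ℝ :=
  ∑ j : Fin (n - m + 1),
    (-1 : ℝ) ^ ((m : ℤ) - (i : ℕ) + (j : ℕ)) *
      (elemSymm w ((m : ℤ) - (i : ℕ) + (j : ℕ))).re * t j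

/-- The integrand in the definition of `ρ_m`. -/
def rhoIntegrand {n : ℕ} (f : Fin (n + 1) → ℝ → ℝ) {m : ℕ} (w : Fin m → ℂ)
    (t : Fin (n - m + 1) → ℝ) : ℝ :=
  (∏ i : Fin (n + 1), f i (rhoCoeff n w t i)) *
    ∏ i : Fin m, ‖∑ j : Fin (n - m + 1), (t j : ℂ) * w i ^ (j : ℕ)‖

/-- The function `ρ_m(w₁, …, w_m)` (for `m ≤ n`). -/
def rho {n : ℕ} (f : Fin (n + 1) → ℝ → ℝ) {m : ℕ} (w : Fin m → ℂ) : ℝ :=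
  absVandermonde w * ∫ t : Fin (n - m + 1) → ℝ, rhoIntegrand f w t

/-- The point `(x, z, z̄)` of `ℂ^{k+2l}`. -/
def conjTuple {k l : ℕ} (x : Fin k → ℝ) (z : Fin l → ℂ) : Fin (k + l + l) → ℂ :=
  Fin.append (Fin.append (fun i => (x i : ℂ)) z) (fun j => (starRingEnd ℂ) (z j))

end

/-! By independence the coefficient vector has a joint density, so the expectation is `∫ h(a) ∏
#(roots of G_a in the given sets) da` with `h` the product of the `f_i`. The formula is proved for
every measurable `h ≥ 0` against Lebesgue measure: it is a change of variables `a ↔ (w, t)`, where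
`G = ∏ (X - w_i) · t(X)`, `w` lists the chosen roots with their conjugates, and `t` holds the
coefficients of the cofactor. Its Jacobian is `∏_{i<j} |w_i - w_j| · ∏ |t(w_i)|`, times 2 for each
conjugate pair.

The Jacobian is never computed as one large determinant; roots are split off one at a time. For a
real root, fix `a₁, …, a_n`. Then `x` is a root iff `a₀ = -x (a₁ + a₂ x + ⋯)`, so the number of
roots is the cardinality of a fibre, and the area formula (`lintegral_mul_encard_fiber`) turns its
integral over `a₀` into an integral over `x` with weight `|G'(x)|`. Writing `G = (X - x) q`, the
upper coefficients of `G` are a unitriangular image of those of `q` (`lintegral_coeff_monic_mul`),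
and `G'(x) = q(x)`. For a root `z` in the upper half-plane, `(a₀, a₁)` plays the role of `a₀`; the
Jacobian is `|G'(z)|² / Im z = 4 Im z |q(z)|²`. Since `4 Im z = 2 |z - z̄|` and `|q(z)|² = |q(z)|
|q(z̄)|`, each pair contributes the factor 2.

Because the sets are disjoint, the roots of `G` in the remaining sets are those of `q`, and the
procedure can be repeated (`lintegral_mul_prod_rootCount`). The successive values `q(x)` and `q(z)`
contain the later linear factors, whose product builds up the Vandermonde factor.

Almost surely `G ≠ 0`, so the counts are bounded and both sides are finite on every product of
disjoint sets. Almost every configuration has distinct points, hence lies in one of countably many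
such products with basic open factors; this gives almost everywhere convergence and reduces
uniqueness to comparing finite measures on boxes. -/

noncomputable section

open Polynomial

/-! ### The area formula -/

section AreaFormula

variable {E : Type*} [NormedAddCommGroup E] [NormedSpace ℝ E] [FiniteDimensional ℝ E]
  [MeasurableSpace E] [BorelSpace E]

/-- A differentiable map with invertible derivatives is injective on each piece of a countable
measurable partition. -/
theorem exists_partition_injOn_of_det_ne_zero {s : Set E} {f : E → E} {f' : E → E →L[ℝ] E}
    (hf' : ∀ x ∈ s, HasFDerivWithinAt f (f' x) s x) (hdet : ∀ x ∈ s, (f' x).det ≠ 0) :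
    ∃ t : ℕ → Set E, Pairwise (Function.onFun Disjoint t) ∧ (∀ n, MeasurableSet (t n)) ∧
      s ⊆ ⋃ n, t n ∧ ∀ n, Set.InjOn f (s ∩ t n) := by
  classical
  rcases s.eq_empty_or_nonempty with rfl | hs
  · exact ⟨fun _ => ∅, fun _ _ _ => by simp [Function.onFun], fun _ => MeasurableSet.empty,
      by simp, by simp⟩
  have key : ∀ A : E →L[ℝ] E, ∃ r : NNReal, r ≠ 0 ∧ (A.det ≠ 0 → ∀ u : Set E,
      ApproximatesLinearOn f A u r → Set.InjOn f u) := by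
    intro A
    by_cases hA : A.det = 0
    · exact ⟨1, one_ne_zero, fun h => absurd hA h⟩
    · let B := A.toContinuousLinearEquivOfDetNeZero hA
      have hB : (B : E →L[ℝ] E) = A := A.coe_toContinuousLinearEquivOfDetNeZero hA
      rcases subsingleton_or_nontrivial E with hE | hE
      · exact ⟨1, one_ne_zero, fun _ u _ x _ y _ _ => Subsingleton.elim x y⟩
      · have hpos : 0 < ‖(B.symm : E →L[ℝ] E)‖₊⁻¹ := by
          simpa using B.symm.symm.nnnorm_symm_pos
        refine ⟨‖(B.symm : E →L[ℝ] E)‖₊⁻¹ / 2, (half_pos hpos).ne', fun _ u hu => ?_⟩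
        rw [← hB] at hu
        exact hu.injOn (Or.inr (NNReal.half_lt_self hpos.ne'))
  choose r r0 hr using key
  obtain ⟨t, A, t1, t2, t3, t4, t5⟩ :=
    exists_partition_approximatesLinearOn_of_hasFDerivWithinAt f s f' hf' r r0
  refine ⟨t, t1, t2, t3, fun n => ?_⟩
  obtain ⟨y, hy, hAy⟩ := t5 hs n
  exact hr (A n) (hAy ▸ hdet y hy) _ (t4 n)

/-- On each injectivity piece the usual change of variables applies. A fibre meets a piece in at
most one point, so its cardinality is the sum of the indicators of the images of the pieces. -/
theorem lintegral_mul_encard_fiber_of_det_ne_zero (μ : Measure E) [μ.IsAddHaarMeasure]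
    {s : Set E} {f : E → E} {f' : E → E →L[ℝ] E} (hs : MeasurableSet s)
    (hf' : ∀ x ∈ s, HasFDerivWithinAt f (f' x) s x) (hdet : ∀ x ∈ s, (f' x).det ≠ 0)
    {g : E → ENNReal} (hg : Measurable g) :
    ∫⁻ y, g y * ({x ∈ s | f x = y}.encard : ENNReal) ∂μ =
      ∫⁻ x in s, ENNReal.ofReal |(f' x).det| * g (f x) ∂μ := by
  obtain ⟨t, t1, t2, t3, t4⟩ := exists_partition_injOn_of_det_ne_zero hf' hdet
  have hd (n : ℕ) : ∀ x ∈ s ∩ t n, HasFDerivWithinAt f (f' x) (s ∩ t n) x :=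
    fun x hx => (hf' x hx.1).mono Set.inter_subset_left
  have hms (n : ℕ) : MeasurableSet (s ∩ t n) := hs.inter (t2 n)
  have hunion : s = ⋃ n, s ∩ t n := by rw [← Set.inter_iUnion, Set.inter_eq_left.2 t3]
  have hcard (y : E) : ({x ∈ s | f x = y}.encard : ENNReal) =
      ∑' n, (f '' (s ∩ t n)).indicator 1 y := by
    have h1 : {x ∈ s | f x = y} = ⋃ n, {x ∈ s ∩ t n | f x = y} := by
      conv_lhs => rw [hunion]
      ext x
      simp only [Set.mem_iUnion, Set.mem_ofPred_eq]
      tauto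
    rw [h1, ← ENNReal.tsum_set_one, ENNReal.tsum_biUnion (f := fun _ => (1 : ENNReal))]
    · refine tsum_congr fun n => ?_
      rw [ENNReal.tsum_set_one]
      by_cases hy : y ∈ f '' (s ∩ t n)
      · rw [Set.indicator_of_mem hy]
        obtain ⟨x, hx, rfl⟩ := hy
        have : {x' ∈ s ∩ t n | f x' = f x} = {x} := by
          ext x'
          exact ⟨fun h => t4 n h.1 hx h.2, fun h => by rw [h]; exact ⟨hx, rfl⟩⟩
        rw [this]; simp
      · rw [Set.indicator_of_notMem hy]
        have : {x' ∈ s ∩ t n | f x' = y} = ∅ := by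
          ext x'
          simp only [Set.mem_ofPred_eq, Set.mem_empty_iff_false, iff_false]
          exact fun h => hy ⟨x', h⟩
        rw [this]; simp
    · intro i _ j _ hij
      refine (t1 hij).mono ?_ ?_ <;> exact fun x hx => hx.1.2
  have him (n : ℕ) : MeasurableSet (f '' (s ∩ t n)) :=
    measurable_image_of_fderivWithin (hms n) (hd n) (t4 n)
  simp_rw [hcard, ← ENNReal.tsum_mul_left]
  rw [lintegral_tsum (f := fun n y => g y * (f '' (s ∩ t n)).indicator 1 y)
    fun n => (hg.mul (measurable_one.indicator (him n))).aemeasurable]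
  conv_rhs => rw [hunion]
  rw [lintegral_iUnion hms fun i j hij => (t1 hij).mono Set.inter_subset_right
    Set.inter_subset_right]
  refine tsum_congr fun n => ?_
  rw [← lintegral_image_eq_lintegral_abs_det_fderiv_mul μ (hms n) (hd n) (t4 n),
    ← lintegral_indicator (him n)]
  refine lintegral_congr fun y => ?_
  by_cases hy : y ∈ f '' (s ∩ t n) <;> simp [hy]

/-- The area formula: the change of variables formula for maps that need not be injective. -/
theorem lintegral_mul_encard_fiber (μ : Measure E) [μ.IsAddHaarMeasure]
    {s : Set E} {f : E → E} {f' : E → E →L[ℝ] E} (hs : MeasurableSet s)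
    (hf' : ∀ x ∈ s, HasFDerivWithinAt f (f' x) s x) (hdet : MeasurableSet {x ∈ s | (f' x).det = 0})
    {g : E → ENNReal} (hg : Measurable g) :
    ∫⁻ y, g y * ({x ∈ s | f x = y}.encard : ENNReal) ∂μ =
      ∫⁻ x in s, ENNReal.ofReal |(f' x).det| * g (f x) ∂μ := by
  set s₀ := {x ∈ s | (f' x).det = 0} with hs₀
  have hsub : s \ s₀ ⊆ s := Set.sdiff_subset
  -- Sard: critical points affect the fibres only over a null set, and on the right their weight is
  -- zero.
  have hnull : μ (f '' s₀) = 0 := addHaar_image_eq_zero_of_det_fderivWithin_eq_zero μ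
    (fun x hx => (hf' x hx.1).mono (Set.sep_subset _ _)) fun x hx => hx.2
  have hmain := lintegral_mul_encard_fiber_of_det_ne_zero μ (hs.diff hdet)
    (fun x hx => (hf' x hx.1).mono hsub) (fun x hx h => hx.2 ⟨hx.1, h⟩) hg
  have hleft : ∫⁻ y, g y * ({x ∈ s | f x = y}.encard : ENNReal) ∂μ =
      ∫⁻ y, g y * ({x ∈ s \ s₀ | f x = y}.encard : ENNReal) ∂μ := by
    refine lintegral_congr_ae ?_
    filter_upwards [compl_mem_ae_iff.2 hnull] with y hy
    congr 3
    ext x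
    exact ⟨fun h => ⟨⟨h.1, fun h0 => hy ⟨x, h0, h.2⟩⟩, h.2⟩, fun h => ⟨h.1.1, h.2⟩⟩
  rw [hleft, hmain, ← lintegral_inter_add_sdiff _ s hdet]
  have h0 : ∫⁻ x in s ∩ s₀, ENNReal.ofReal |(f' x).det| * g (f x) ∂μ = 0 := by
    rw [setLIntegral_congr_fun (g := fun _ => 0) (hs.inter hdet) fun x hx => by simp [hx.2.2]]
    simp
  rw [h0, zero_add]

end AreaFormula

/-! ### Polynomials with given coefficients and their roots -/

/-- The polynomial `∑ i < N, aᵢ Xⁱ`. -/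
def polyOfVec {N : ℕ} (a : Fin N → ℝ) : ℝ[X] := ∑ i : Fin N, monomial (i : ℕ) (a i)

/-- The vector of the first `N` coefficients. -/
def coeffVec (N : ℕ) (p : ℝ[X]) : Fin N → ℝ := fun i => p.coeff i

theorem coeff_polyOfVec {N : ℕ} (a : Fin N → ℝ) (i : ℕ) :
    (polyOfVec a).coeff i = if h : i < N then a ⟨i, h⟩ else 0 := by
  simp only [polyOfVec, finsetSum_coeff, coeff_monomial]
  split_ifs with h
  · rw [Finset.sum_eq_single ⟨i, h⟩]
    · simp
    · intro j _ hj
      rw [if_neg fun h' => hj (Fin.ext h')]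
    · simp
  · exact Finset.sum_eq_zero fun j _ => if_neg (by lia)

theorem coeffVec_polyOfVec {N : ℕ} (a : Fin N → ℝ) : coeffVec N (polyOfVec a) = a := by
  ext i; simp [coeffVec, coeff_polyOfVec]

theorem degree_polyOfVec_lt {N : ℕ} (a : Fin N → ℝ) : (polyOfVec a).degree < N := by
  rw [degree_lt_iff_coeff_zero]
  intro m hm
  rw [coeff_polyOfVec, dif_neg (by lia)]

theorem polyOfVec_coeffVec {N : ℕ} {p : ℝ[X]} (hp : p.degree < N) :
    polyOfVec (coeffVec N p) = p := by
  ext i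
  rw [coeff_polyOfVec]
  split_ifs with h
  · rfl
  · exact ((degree_lt_iff_coeff_zero _ _).1 hp i (by lia)).symm

theorem polyOfVec_eq_zero_iff {N : ℕ} {a : Fin N → ℝ} : polyOfVec a = 0 ↔ a = 0 := by
  constructor
  · intro h
    rw [← coeffVec_polyOfVec a, h]; ext; simp [coeffVec]
  · rintro rfl; simp [polyOfVec]

theorem aeval_polyOfVec {N : ℕ} (a : Fin N → ℝ) (z : ℂ) :
    aeval z (polyOfVec a) = ∑ i : Fin N, (a i : ℂ) * z ^ (i : ℕ) := by
  simp [polyOfVec, aeval_monomial]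

theorem eval_polyOfVec {N : ℕ} (a : Fin N → ℝ) (x : ℝ) :
    eval x (polyOfVec a) = ∑ i : Fin N, a i * x ^ (i : ℕ) := by
  simp [polyOfVec, eval_finsetSum]

theorem polyOfVec_cons {N : ℕ} (a₀ : ℝ) (a : Fin N → ℝ) :
    polyOfVec (Fin.cons a₀ a : Fin (N + 1) → ℝ) = C a₀ + X * polyOfVec a := by
  simp [polyOfVec, Fin.sum_univ_succ, Finset.mul_sum, X_mul_monomial]

/-- The number of roots in `B`, without multiplicities. -/
def rootCount {N : ℕ} (a : Fin N → ℝ) (B : Set ℂ) : ENNReal :=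
  ({z ∈ B | aeval z (polyOfVec a) = 0}.encard : ENNReal)

theorem finite_roots {N : ℕ} {a : Fin N → ℝ} (ha : a ≠ 0) :
    {z : ℂ | aeval z (polyOfVec a) = 0}.Finite := by
  have h : polyOfVec a ≠ 0 := fun h => ha (polyOfVec_eq_zero_iff.1 h)
  refine ((polyOfVec a).rootSet_finite ℂ).subset fun z hz => ?_
  rw [mem_rootSet]
  exact ⟨h, hz⟩

theorem rootCount_le {N : ℕ} {a : Fin N → ℝ} (ha : a ≠ 0) (B : Set ℂ) : rootCount a B ≤ N := by
  classical
  have h : polyOfVec a ≠ 0 := fun h => ha (polyOfVec_eq_zero_iff.1 h)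
  have hsub : {z ∈ B | aeval z (polyOfVec a) = 0} ⊆ ((polyOfVec a).aroots ℂ).toFinset := by
    intro z hz
    simpa [h] using hz.2
  have h1 := Set.encard_le_encard hsub
  rw [Set.encard_coe_eq_coe_finsetCard] at h1
  have h2 : ((polyOfVec a).aroots ℂ).toFinset.card ≤ N :=
    (Multiset.toFinset_card_le _).trans
      ((card_roots_map_le_natDegree _).trans
        (natDegree_le_of_degree_le (degree_polyOfVec_lt a).le))
  unfold rootCount
  have h3 : {z ∈ B | aeval z (polyOfVec a) = 0}.encard ≤ (N : ℕ∞) :=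
    h1.trans (by exact_mod_cast h2)
  exact_mod_cast ENat.toENNReal_le.2 h3

/-! ### Measurability of the root count in the coefficients -/

theorem continuous_aeval_polyOfVec (N : ℕ) :
    Continuous fun p : (Fin N → ℝ) × ℂ => aeval p.2 (polyOfVec p.1) := by
  simp_rw [aeval_polyOfVec]
  fun_prop

/-- The set of polynomials with at least `j` roots in an open set is measurable. -/
theorem measurableSet_le_encard_roots {N : ℕ} {U : Set ℂ} (hU : IsOpen U) (j : ℕ) :
    MeasurableSet {a : Fin N → ℝ | (j : ℕ∞) ≤ {z ∈ U | aeval z (polyOfVec a) = 0}.encard} := by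
  set S : Set ((Fin N → ℝ) × (Fin j → ℂ)) :=
    {p | (∀ i, p.2 i ∈ U) ∧ Function.Injective p.2} ∩
      {p | ∀ i, aeval (p.2 i) (polyOfVec p.1) = 0} with hS
  have hopen : IsOpen {p : (Fin N → ℝ) × (Fin j → ℂ) | (∀ i, p.2 i ∈ U) ∧
      Function.Injective p.2} := by
    simp only [Set.ofPred_and, Set.ofPred_forall, Function.Injective]
    refine (isOpen_iInter_of_finite fun i => hU.preimage (by fun_prop)).inter
      (isOpen_iInter_of_finite fun i => isOpen_iInter_of_finite fun i' => ?_)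
    by_cases h : i = i'
    · simp [h]
    · simp only [h, imp_false]
      exact isOpen_ne_fun (by fun_prop) (by fun_prop)
  have hclosed : IsClosed {p : (Fin N → ℝ) × (Fin j → ℂ) |
      ∀ i, aeval (p.2 i) (polyOfVec p.1) = 0} := by
    simp only [Set.ofPred_forall]
    exact isClosed_iInter fun i => isClosed_eq
      ((continuous_aeval_polyOfVec N).comp
        (f := fun p : (Fin N → ℝ) × (Fin j → ℂ) => (p.1, p.2 i)) (by fun_prop)) (by fun_prop)
  -- A locally closed subset of a finite-dimensional space is σ-compact, hence so is its projection,
  -- which is therefore Borel.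
  have hlc : IsLocallyClosed S := ⟨_, _, hopen, hclosed, rfl⟩
  have := hlc.locallyCompactSpace
  have hσ : IsSigmaCompact S := isSigmaCompact_iff_sigmaCompactSpace.2 inferInstance
  have himage : {a : Fin N → ℝ | (j : ℕ∞) ≤ {z ∈ U | aeval z (polyOfVec a) = 0}.encard} =
      Prod.fst '' S := by
    ext a
    simp only [Set.mem_ofPred_eq, Set.mem_image, Prod.exists, exists_and_right, exists_eq_right]
    constructor
    · intro h
      obtain ⟨t, hts, htj⟩ := Set.exists_subset_encard_eq h
      have htf : t.Finite := Set.finite_of_encard_eq_coe htj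
      have hcard : htf.toFinset.card = j := by
        rw [htf.encard_eq_coe_toFinset_card] at htj
        exact_mod_cast htj
      let e := htf.toFinset.equivFinOfCardEq hcard
      have hmem (i : Fin j) : (e.symm i : ℂ) ∈ t := htf.mem_toFinset.1 (e.symm i).2
      exact ⟨fun i => e.symm i, ⟨fun i => (hts (hmem i)).1,
        fun i i' h => e.symm.injective (Subtype.ext h)⟩, fun i => (hts (hmem i)).2⟩
    · rintro ⟨z, ⟨hzU, hzi⟩, hz⟩
      calc (j : ℕ∞) = (Set.range z).encard := by
            rw [← Set.image_univ, hzi.encard_image]; simp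
        _ ≤ _ := Set.encard_le_encard (by rintro _ ⟨i, rfl⟩; exact ⟨hzU i, hz i⟩)
  rw [himage]
  obtain ⟨K, hK, hKS⟩ := hσ.image continuous_fst
  rw [← hKS]
  exact MeasurableSet.iUnion fun n => (hK n).isClosed.measurableSet

theorem measurable_rootCount_of_isOpen {N : ℕ} {U : Set ℂ} (hU : IsOpen U) :
    Measurable fun a : Fin N → ℝ => rootCount a U := by
  refine (Measurable.of_discrete (f := fun e : ℕ∞ => (e : ENNReal))).comp
    (ENat.measurable_iff.2 fun j => ?_)
  have : (fun a : Fin N → ℝ => {z ∈ U | aeval z (polyOfVec a) = 0}.encard) ⁻¹' {(j : ℕ∞)} =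
      {a | (j : ℕ∞) ≤ {z ∈ U | aeval z (polyOfVec a) = 0}.encard} \
        {a | ((j + 1 : ℕ) : ℕ∞) ≤ {z ∈ U | aeval z (polyOfVec a) = 0}.encard} := by
    ext a
    simp only [Set.mem_preimage, Set.mem_singleton_iff, Set.mem_sdiff, Set.mem_ofPred_eq, not_le]
    rw [Nat.cast_add, Nat.cast_one, ENat.lt_add_one_iff (ENat.natCast_ne_top j), and_comm]
    exact le_antisymm_iff
  rw [this]
  exact (measurableSet_le_encard_roots hU j).diff (measurableSet_le_encard_roots hU (j + 1))

/-- The root sets define a family of counting measures, and measurability passes from open sets to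
Borel sets by a π-λ argument. -/
theorem measurable_rootCount {N : ℕ} {B : Set ℂ} (hB : MeasurableSet B) :
    Measurable fun a : Fin N → ℝ => rootCount a B := by
  classical
  -- The π-λ argument needs finite measures, so the zero polynomial, which vanishes everywhere, is
  -- treated separately.
  let Z (a : Fin N → ℝ) : Set ℂ := if a = 0 then ∅ else {z | aeval z (polyOfVec a) = 0}
  have hZfin (a) : (Z a).Finite := by
    simp only [Z]; split_ifs with h
    · exact Set.finite_empty
    · exact finite_roots h
  let ν (a : Fin N → ℝ) : Measure ℂ := Measure.count.restrict (Z a)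
  have hν (a) {C : Set ℂ} (hC : MeasurableSet C) :
      ν a C = if a = 0 then 0 else rootCount a C := by
    simp only [ν]
    rw [Measure.restrict_apply hC,
      Measure.count_apply ((hZfin a).subset Set.inter_subset_right).measurableSet]
    simp only [Z]
    split_ifs with h
    · simp
    · rfl
  have hfin (a) : IsFiniteMeasure (ν a) := by
    refine ⟨?_⟩
    rw [hν a MeasurableSet.univ]
    split_ifs with h
    · simp
    · exact (rootCount_le h _).trans_lt (by simp)
  have h0 : MeasurableSet {a : Fin N → ℝ | a = 0} := measurableSet_eq
  have hopen {U : Set ℂ} (hU : IsOpen U) : Measurable fun a => ν a U := by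
    simp_rw [hν _ hU.measurableSet]
    exact Measurable.ite h0 measurable_const (measurable_rootCount_of_isOpen hU)
  have hmeas : Measurable ν := Measurable.measure_of_isPiSystem
    (BorelSpace.measurable_eq.trans rfl) isPiSystem_isOpen (fun U hU => hopen hU)
    (hopen isOpen_univ)
  have : (fun a : Fin N → ℝ => rootCount a B) =
      fun a => if a = 0 then rootCount (0 : Fin N → ℝ) B else ν a B := by
    ext a
    split_ifs with h
    · rw [h]
    · rw [hν a hB, if_neg h]
  rw [this]
  exact Measurable.ite h0 measurable_const (Measure.measurable_measure.1 hmeas B hB)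

/-! ### Integrals over vectors -/

theorem lintegral_finCons {E : Type*} [MeasureSpace E] [SigmaFinite (volume : Measure E)] {N : ℕ}
    {F : (Fin (N + 1) → E) → ENNReal} (hF : Measurable F) :
    ∫⁻ a, F a = ∫⁻ a₀ : E, ∫⁻ a : Fin N → E, F (Fin.cons a₀ a) := by
  have h := (volume_preserving_piFinSuccAbove (fun _ : Fin (N + 1) => E) 0).symm
  rw [← h.lintegral_comp hF, Measure.volume_eq_prod, lintegral_prod]
  · simp [MeasurableEquiv.piFinSuccAbove, Fin.insertNthEquiv]
  · exact (hF.comp (MeasurableEquiv.measurable _)).aemeasurable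

/-! ### Multiplication by a monic polynomial preserves Lebesgue measure on the top coefficients -/

/-- The map from `q` to the coefficients of `p q` of index `r, …, r + N - 1` has matrix entries
`p_{i+r-j}`. These vanish for `j < i` and equal the leading coefficient 1 on the diagonal, so the
determinant is 1. -/
theorem lintegral_coeff_monic_mul {p : ℝ[X]} {r : ℕ} (hp : p.Monic) (hr : p.natDegree = r) {N : ℕ}
    {F : (Fin N → ℝ) → ENNReal} (hF : Measurable F) :
    ∫⁻ a, F a = ∫⁻ q : Fin N → ℝ, F fun i => (p * polyOfVec q).coeff (i + r) := by
  classical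
  let M : Matrix (Fin N) (Fin N) ℝ :=
    Matrix.of fun i j => if (j : ℕ) ≤ i + r then p.coeff (i + r - j) else 0
  have hM : ∀ q : Fin N → ℝ, Matrix.toLin' M q = fun i : Fin N => (p * polyOfVec q).coeff (i + r) := by
    intro q
    ext i
    simp only [Matrix.toLin'_apply, Matrix.mulVec, dotProduct, polyOfVec, Finset.mul_sum,
      finsetSum_coeff, M, Matrix.of_apply]
    refine Finset.sum_congr rfl fun j _ => ?_
    rw [← C_mul_X_pow_eq_monomial, mul_left_comm, coeff_C_mul, coeff_mul_X_pow', mul_comm]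
  have hdet : M.det = 1 := by
    rw [Matrix.det_of_isUpperTriangular]
    · refine Finset.prod_eq_one fun i _ => ?_
      simp only [M, Matrix.of_apply, Nat.le_add_right, if_true, Nat.add_sub_cancel_left]
      rw [← hr]; exact hp
    · intro i j hij
      have hij' : (j : ℕ) < i := hij
      simp only [M, Matrix.of_apply]
      rw [if_pos (by lia)]
      exact coeff_eq_zero_of_natDegree_lt (by lia)
  have hmap := Real.map_matrix_volume_pi_eq_smul_volume_pi (M := M) (by rw [hdet]; exact one_ne_zero)
  rw [hdet] at hmap
  simp only [inv_one, abs_one, ENNReal.ofReal_one, one_smul] at hmap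
  conv_lhs => rw [← hmap]
  rw [lintegral_map hF (Matrix.toLin' M).continuous_of_finiteDimensional.measurable]
  simp_rw [hM]

theorem eq_C_add_X_mul_polyOfVec {N : ℕ} {P : ℝ[X]} (hP : P.degree < ((N + 1 : ℕ) : WithBot ℕ)) :
    P = C (P.coeff 0) + X * polyOfVec fun i : Fin N => P.coeff (i + 1) := by
  ext i
  rcases i with _ | i
  · simp
  · simp only [coeff_add, coeff_C_succ, coeff_X_mul, zero_add, coeff_polyOfVec]
    split_ifs with h
    · rfl
    · exact (degree_lt_iff_coeff_zero _ _).1 hP _ (by lia)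

theorem coeffVec_succ (N : ℕ) (P : ℝ[X]) :
    coeffVec (N + 1) P = Fin.cons (P.coeff 0) fun i : Fin N => P.coeff (i + 1) := by
  ext i
  refine Fin.cases ?_ (fun i => ?_) i <;> simp [coeffVec]

theorem degree_mul_polyOfVec_lt {p : ℝ[X]} {r N M : ℕ} (hp : p.degree ≤ r) (hM : M = N + r)
    (q : Fin N → ℝ) : (p * polyOfVec q).degree < (M : WithBot ℕ) := by
  rcases eq_or_ne (p * polyOfVec q) 0 with h | h
  · rw [h, degree_zero]; exact WithBot.bot_lt_coe _
  have hq : polyOfVec q ≠ 0 := right_ne_zero_of_mul h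
  have hp0 : p ≠ 0 := left_ne_zero_of_mul h
  have h1 := degree_polyOfVec_lt q
  rw [degree_mul]
  rw [degree_eq_natDegree hq] at h1 ⊢
  rw [degree_eq_natDegree hp0] at hp ⊢
  norm_cast at *
  lia

/-! ### Splitting off a real root -/

theorem measurable_coeffVec_mul {β : Type*} [MeasurableSpace β] {p : β → ℝ[X]}
    (hp : ∀ i, Measurable fun b => (p b).coeff i) (N M : ℕ) :
    Measurable fun b : β × (Fin N → ℝ) => coeffVec M (p b.1 * polyOfVec b.2) := by
  refine measurable_pi_lambda _ fun i => ?_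
  simp only [coeffVec, coeff_mul, coeff_polyOfVec]
  refine Finset.measurable_sum _ fun x _ => ((hp _).comp measurable_fst).mul ?_
  split_ifs with h
  · exact (measurable_pi_apply _).comp measurable_snd
  · exact measurable_const

theorem measurable_finCons {E : Type*} [MeasurableSpace E] (N : ℕ) :
    Measurable fun p : E × (Fin N → E) => (Fin.cons p.1 p.2 : Fin (N + 1) → E) :=
  measurable_pi_lambda _ fun i => by
    refine Fin.cases ?_ (fun j => ?_) i
    · simpa using measurable_fst
    · simpa using (measurable_pi_apply j).fun_comp measurable_snd

theorem measurableSet_ofReal_image {B : Set ℝ} (hB : MeasurableSet B) :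
    MeasurableSet (Complex.ofReal '' B) :=
  Complex.isometry_ofReal.isClosedEmbedding.measurableEmbedding.measurableSet_image.2 hB

theorem continuous_eval_polyOfVec (N : ℕ) :
    Continuous fun p : (Fin N → ℝ) × ℝ => eval p.2 (polyOfVec p.1) := by
  simp_rw [eval_polyOfVec]
  fun_prop

theorem continuous_eval_derivative_polyOfVec (N : ℕ) :
    Continuous fun p : (Fin N → ℝ) × ℝ => eval p.2 (derivative (polyOfVec p.1)) := by
  simp_rw [polyOfVec, derivative_sum, derivative_monomial, eval_finsetSum, eval_monomial]
  fun_prop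

/-- With the higher coefficients fixed, the roots in `B` form the fibre over `a₀` of `x ↦ -x ·
a(x)`, so this is the area formula in dimension one. -/
theorem lintegral_mul_rootCount_finCons_real {N : ℕ} (a : Fin N → ℝ) {g : ℝ → ENNReal}
    (hg : Measurable g) {B : Set ℝ} (hB : MeasurableSet B) :
    ∫⁻ a₀ : ℝ, g a₀ * rootCount (Fin.cons a₀ a : Fin (N + 1) → ℝ) (Complex.ofReal '' B) =
      ∫⁻ x in B, ENNReal.ofReal |eval x (derivative (X * polyOfVec a))| *
        g (-eval x (X * polyOfVec a)) := by
  have hcount (a₀ : ℝ) : rootCount (Fin.cons a₀ a : Fin (N + 1) → ℝ) (Complex.ofReal '' B) =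
      ({x ∈ B | -eval x (X * polyOfVec a) = a₀}.encard : ENNReal) := by
    have hroot (x : ℝ) : aeval (x : ℂ) (polyOfVec (Fin.cons a₀ a : Fin (N + 1) → ℝ)) = 0 ↔
        -eval x (X * polyOfVec a) = a₀ := by
      rw [show ((x : ℂ)) = algebraMap ℝ ℂ x from rfl, aeval_algebraMap_apply_eq_algebraMap_eval,
        polyOfVec_cons, eval_add, eval_C, map_eq_zero]
      exact ⟨fun h => by linarith, fun h => by linarith⟩
    have : {z ∈ Complex.ofReal '' B | aeval z (polyOfVec (Fin.cons a₀ a : Fin (N + 1) → ℝ)) = 0} =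
        Complex.ofReal '' {x ∈ B | -eval x (X * polyOfVec a) = a₀} := by
      ext z
      constructor
      · rintro ⟨⟨x, hx, rfl⟩, hz⟩
        exact ⟨x, ⟨hx, (hroot x).1 hz⟩, rfl⟩
      · rintro ⟨x, ⟨hx, hx'⟩, rfl⟩
        exact ⟨⟨x, hx, rfl⟩, (hroot x).2 hx'⟩
    rw [rootCount, this, Complex.ofReal_injective.encard_image]
  simp_rw [hcount]
  have := lintegral_mul_encard_fiber (volume : Measure ℝ) hB
    (f := fun x => -eval x (X * polyOfVec a))
    (f' := fun x => ContinuousLinearMap.toSpanSingleton ℝ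
      (-eval x (derivative (X * polyOfVec a))))
    (fun x _ => ((X * polyOfVec a).hasDerivAt x).neg.hasFDerivAt.hasFDerivWithinAt) (by
      simp only [ContinuousLinearMap.det_toSpanSingleton]
      exact hB.inter (measurableSet_eq_fun (by fun_prop) measurable_const)) hg
  simpa only [ContinuousLinearMap.det_toSpanSingleton, abs_neg] using this

/-- One step of the change of variables: the constant coefficient is traded for a real root `x`,
then the other coefficients for those of the cofactor `q`. -/
theorem lintegral_mul_rootCount_real {N : ℕ} {h : (Fin (N + 1) → ℝ) → ENNReal} (hh : Measurable h)
    {B : Set ℝ} (hB : MeasurableSet B) :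
    ∫⁻ a, h a * rootCount a (Complex.ofReal '' B) =
      ∫⁻ x in B, ∫⁻ q : Fin N → ℝ, h (coeffVec (N + 1) ((X - C x) * polyOfVec q)) *
        ENNReal.ofReal |eval x (polyOfVec q)| := by
  have hcons := measurable_finCons (E := ℝ) N
  have hF : Measurable fun a : Fin (N + 1) → ℝ => h a * rootCount a (Complex.ofReal '' B) :=
    hh.mul (measurable_rootCount (measurableSet_ofReal_image hB))
  rw [lintegral_finCons hF, lintegral_lintegral_swap (f := fun a₀ a => h (Fin.cons a₀ a) *
    rootCount (Fin.cons a₀ a : Fin (N + 1) → ℝ) (Complex.ofReal '' B)) (hF.comp hcons).aemeasurable]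
  have hinner (a : Fin N → ℝ) := lintegral_mul_rootCount_finCons_real a
    (g := fun a₀ => h (Fin.cons a₀ a))
    (hh.comp (hcons.comp (measurable_id.prodMk measurable_const))) hB
  simp_rw [hinner]
  have hφ : Measurable fun p : (Fin N → ℝ) × ℝ => -eval p.2 (X * polyOfVec p.1) := by
    simp only [eval_mul, eval_X]
    exact (measurable_snd.mul (continuous_eval_polyOfVec N).measurable).neg
  have hφ' : Measurable fun p : (Fin N → ℝ) × ℝ => eval p.2 (derivative (X * polyOfVec p.1)) := by
    simp only [derivative_mul, derivative_X, one_mul, eval_add, eval_mul, eval_X]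
    exact (continuous_eval_polyOfVec N).measurable.add
      (measurable_snd.mul (continuous_eval_derivative_polyOfVec N).measurable)
  have hG : Measurable fun p : (Fin N → ℝ) × ℝ =>
      ENNReal.ofReal |eval p.2 (derivative (X * polyOfVec p.1))| *
        h (Fin.cons (-eval p.2 (X * polyOfVec p.1)) p.1) :=
    hφ'.abs.ennreal_ofReal.mul (hh.comp (hcons.comp (hφ.prodMk measurable_fst)))
  rw [lintegral_lintegral_swap (f := fun a x =>
    ENNReal.ofReal |eval x (derivative (X * polyOfVec a))| *
        h (Fin.cons (-eval x (X * polyOfVec a)) a)) hG.aemeasurable]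
  refine lintegral_congr fun x => ?_
  rw [lintegral_coeff_monic_mul (monic_X_sub_C x) (natDegree_X_sub_C x)
    (F := fun a => ENNReal.ofReal |eval x (derivative (X * polyOfVec a))| *
        h (Fin.cons (-eval x (X * polyOfVec a)) a))
    (hG.comp (measurable_id.prodMk measurable_const))]
  refine lintegral_congr fun q => ?_
  have hP := eq_C_add_X_mul_polyOfVec (N := N) (degree_mul_polyOfVec_lt (r := 1)
    (degree_X_sub_C_le x) rfl q)
  have h0 : -eval x (X * polyOfVec fun i : Fin N => ((X - C x) * polyOfVec q).coeff (i + 1)) =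
      ((X - C x) * polyOfVec q).coeff 0 := by
    have := congrArg (eval x) hP
    rw [eval_mul, eval_sub, eval_X, eval_C, sub_self, zero_mul, eval_add, eval_C] at this
    linarith
  -- The constant term drops out on differentiating, so the Jacobian is `G'(x)`, and `G = (X - x) q`
  -- gives `G'(x) = q(x)`.
  have h1 : eval x (derivative (X * polyOfVec fun i : Fin N =>
      ((X - C x) * polyOfVec q).coeff (i + 1))) = eval x (polyOfVec q) := by
    have := congrArg (fun p => eval x (derivative p)) hP
    simp only [derivative_add, derivative_C, zero_add] at this
    rw [← this]
    simp
  rw [coeffVec_succ, h0, h1, mul_comm]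

/-! ### Splitting off a pair of conjugate roots -/

/-- The polynomial `(X - z) (X - z̄)`. -/
def conjQuadratic (z : ℂ) : ℝ[X] := X ^ 2 - C (2 * z.re) * X + C (Complex.normSq z)

theorem conjQuadratic_eq (z : ℂ) :
    conjQuadratic z = X ^ 2 + (C (-(2 * z.re)) * X + C (Complex.normSq z)) := by
  simp only [conjQuadratic, C_neg]; ring

theorem map_conjQuadratic (z : ℂ) : (conjQuadratic z).map (algebraMap ℝ ℂ) =
    (X - C z) * (X - C ((starRingEnd ℂ) z)) := by
  have h1 : (C ((2 * z.re : ℝ) : ℂ) : ℂ[X]) = C z + C ((starRingEnd ℂ) z) := by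
    rw [← C_add, Complex.add_conj]
  have h2 : (C ((Complex.normSq z : ℝ) : ℂ) : ℂ[X]) = C z * C ((starRingEnd ℂ) z) := by
    rw [← C_mul, Complex.mul_conj]
  simp only [conjQuadratic, Polynomial.map_add, Polynomial.map_sub, Polynomial.map_pow, map_X,
    Polynomial.map_mul, map_C, Complex.coe_algebraMap] at *
  rw [h1, h2]; ring

theorem aeval_conjQuadratic (z w : ℂ) :
    aeval w (conjQuadratic z) = (w - z) * (w - (starRingEnd ℂ) z) := by
  rw [← eval_map_algebraMap, map_conjQuadratic]; simp

theorem monic_conjQuadratic (z : ℂ) : (conjQuadratic z).Monic := by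
  rw [conjQuadratic_eq]
  exact monic_X_pow_add (degree_linear_le.trans_lt (by norm_num))

theorem natDegree_conjQuadratic (z : ℂ) : (conjQuadratic z).natDegree = 2 := by
  rw [conjQuadratic_eq]
  compute_degree!

theorem degree_conjQuadratic_le (z : ℂ) : (conjQuadratic z).degree ≤ 2 :=
  (degree_le_natDegree).trans (by rw [natDegree_conjQuadratic]; rfl)

/-- The hypothesis says that `L ∘ D` is multiplication by `-c`, where `L v = Re v + z Im v`. As real
maps these have determinants `|c|²` for the multiplication and `Im z` for `L`. -/
theorem det_of_re_add_im_mul {D : ℂ →L[ℝ] ℂ} {z c : ℂ} (hz : 0 < z.im)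
    (h : ∀ v, ((D v).re : ℂ) + (D v).im * z = -(c * v)) : D.det = Complex.normSq c / z.im := by
  let L : ℂ →ₗ[ℝ] ℂ := Complex.ofRealCLM.toLinearMap ∘ₗ Complex.reLm +
    (LinearMap.mulRight ℝ z) ∘ₗ Complex.ofRealCLM.toLinearMap ∘ₗ Complex.imLm
  have hL : L ∘ₗ (D : ℂ →ₗ[ℝ] ℂ) = LinearMap.mulLeft ℝ (-c) := by
    ext v; simp [L, h]
  have hLdet : LinearMap.det L = z.im := by
    rw [← LinearMap.det_toMatrix Complex.basisOneI, Matrix.det_fin_two]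
    simp [LinearMap.toMatrix_apply, L]
  have hc : LinearMap.det (LinearMap.mulLeft ℝ (-c)) = Complex.normSq c := by
    rw [← Complex.normSq_neg, ← Algebra.norm_complex_apply, Algebra.norm_apply]; rfl
  have := congrArg LinearMap.det hL
  rw [LinearMap.det_comp, hLdet, hc] at this
  rw [eq_div_iff hz.ne', mul_comm]
  exact this

theorem lintegral_complex {F : ℝ × ℝ → ENNReal} (hF : Measurable F) :
    ∫⁻ x, ∫⁻ y, F (x, y) = ∫⁻ c : ℂ, F (c.re, c.im) := by
  rw [← lintegral_prod _ hF.aemeasurable, ← Measure.volume_eq_prod,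
    ← Complex.volume_preserving_equiv_real_prod.lintegral_comp hF]
  rfl

/-- The point `c = a₀ + a₁ i` such that `z` is a root of `a₀ + a₁ X + R`. -/
def linearPart (R : ℝ[X]) (z : ℂ) : ℂ :=
  ⟨-(aeval z R).re + (aeval z R).im / z.im * z.re, -((aeval z R).im / z.im)⟩

/-- The Jacobian determinant of `linearPart R`. -/
def linearPartJacobian (R : ℝ[X]) (z : ℂ) : ℝ :=
  Complex.normSq ((linearPart R z).im + aeval z (derivative R)) / z.im

theorem linearPart_eq (R : ℝ[X]) (z : ℂ) : linearPart R z =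
    ((-(aeval z R).re + (aeval z R).im / z.im * z.re : ℝ) : ℂ) +
      ((-((aeval z R).im / z.im) : ℝ) : ℂ) * Complex.I := by
  apply Complex.ext <;> simp [linearPart]

theorem linearPart_eq_iff {R : ℝ[X]} {z c : ℂ} (hz : 0 < z.im) :
    linearPart R z = c ↔ (c.re : ℂ) + c.im * z + aeval z R = 0 := by
  rw [Complex.ext_iff, Complex.ext_iff]
  simp only [linearPart, Complex.add_re, Complex.ofReal_re, Complex.re_ofReal_mul, Complex.zero_re,
    Complex.add_im, Complex.ofReal_im, Complex.im_ofReal_mul, Complex.zero_im, zero_add]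
  have hne := hz.ne'
  constructor
  · rintro ⟨h1, h2⟩
    rw [← h1, ← h2]
    constructor
    · ring
    · field_simp; ring
  · rintro ⟨h1, h2⟩
    have : c.im = -((aeval z R).im / z.im) := by
      field_simp; linarith
    rw [this] at h1
    exact ⟨by linarith, this.symm⟩

theorem hasDerivAt_aeval (R : ℝ[X]) (z : ℂ) :
    HasDerivAt (fun u : ℂ => aeval u R) (aeval z (derivative R)) z := by
  simpa [eval_map_algebraMap, derivative_map] using (R.map (algebraMap ℝ ℂ)).hasDerivAt z

theorem differentiableAt_linearPart (R : ℝ[X]) {z : ℂ} (hz : 0 < z.im) :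
    DifferentiableAt ℝ (linearPart R) z := by
  have hR : DifferentiableAt ℝ (fun u : ℂ => aeval u R) z :=
    (hasDerivAt_aeval R z).differentiableAt.restrictScalars ℝ
  have hre : DifferentiableAt ℝ (fun u : ℂ => (aeval u R).re) z :=
    Complex.reCLM.differentiableAt.comp z hR
  have him : DifferentiableAt ℝ (fun u : ℂ => (aeval u R).im) z :=
    Complex.imCLM.differentiableAt.comp z hR
  have hzre : DifferentiableAt ℝ (fun u : ℂ => u.re) z := Complex.reCLM.differentiableAt
  have hzim : DifferentiableAt ℝ (fun u : ℂ => u.im) z := Complex.imCLM.differentiableAt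
  have hq : DifferentiableAt ℝ (fun u : ℂ => (aeval u R).im / u.im) z := by
    simp_rw [div_eq_mul_inv]
    exact him.fun_mul (hzim.fun_inv hz.ne')
  rw [funext (linearPart_eq R)]
  exact (Complex.ofRealCLM.differentiableAt.comp z (hre.fun_neg.fun_add (hq.fun_mul hzre))).fun_add
    ((Complex.ofRealCLM.differentiableAt.comp z hq.fun_neg).mul_const _)

/-- Implicit differentiation of `a₀(u) + a₁(u) u + R(u) = 0` puts the derivative into the form
required by `det_of_re_add_im_mul`, with `c = a₁(z) + R'(z)`. -/
theorem det_fderiv_linearPart (R : ℝ[X]) {z : ℂ} (hz : 0 < z.im) :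
    (fderiv ℝ (linearPart R) z).det =
      linearPartJacobian R z := by
  set D := fderiv ℝ (linearPart R) z
  have hD : HasFDerivAt (linearPart R) D z := (differentiableAt_linearPart R hz).hasFDerivAt
  refine det_of_re_add_im_mul hz fun v => ?_
  have hre : HasFDerivAt (fun u => ((linearPart R u).re : ℂ))
      (Complex.ofRealCLM.comp (Complex.reCLM.comp D)) z :=
    Complex.ofRealCLM.hasFDerivAt.comp z (Complex.reCLM.hasFDerivAt.comp z hD)
  have him : HasFDerivAt (fun u => ((linearPart R u).im : ℂ))
      (Complex.ofRealCLM.comp (Complex.imCLM.comp D)) z :=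
    Complex.ofRealCLM.hasFDerivAt.comp z (Complex.imCLM.hasFDerivAt.comp z hD)
  have hR := (hasDerivAt_aeval R z).hasFDerivAt.restrictScalars ℝ
  have hsum := (hre.fun_add (him.fun_mul (hasFDerivAt_id (𝕜 := ℝ) z))).fun_add hR
  have hzero : (fun u : ℂ => ((linearPart R u).re : ℂ) + (linearPart R u).im * id u + aeval u R)
      =ᶠ[nhds z] fun _ => 0 := by
    filter_upwards [(isOpen_lt continuous_const Complex.continuous_im).mem_nhds hz] with u hu
    exact (linearPart_eq_iff hu).1 rfl
  have heq := (hsum.congr_of_eventuallyEq hzero.symm).unique (hasFDerivAt_const 0 z)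
  have := congrArg (fun A : ℂ →L[ℝ] ℂ => A v) heq
  simp at this
  linear_combination this

/-- A nonreal root imposes two real linear conditions, which determine `a₀` and `a₁` from the higher
coefficients. The roots in `C` thus form a fibre of `linearPart`, and the area formula is applied in
the plane. -/
theorem lintegral_mul_rootCount_finCons_upper {N : ℕ} (a : Fin N → ℝ) {g : ℝ × ℝ → ENNReal}
    (hg : Measurable g) {C : Set ℂ} (hC : MeasurableSet C) (hC' : C ⊆ {z | 0 < z.im}) :
    ∫⁻ a₀ : ℝ, ∫⁻ a₁ : ℝ, g (a₀, a₁) *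
        rootCount (Fin.cons a₀ (Fin.cons a₁ a : Fin (N + 1) → ℝ) : Fin (N + 2) → ℝ) C =
      ∫⁻ z in C, ENNReal.ofReal (linearPartJacobian (X ^ 2 * polyOfVec a) z) *
        g ((linearPart (X ^ 2 * polyOfVec a) z).re, (linearPart (X ^ 2 * polyOfVec a) z).im) := by
  have hcons : Measurable fun p : ℝ × ℝ =>
      (Fin.cons p.1 (Fin.cons p.2 a : Fin (N + 1) → ℝ) : Fin (N + 2) → ℝ) :=
    (measurable_finCons (N + 1)).comp (measurable_fst.prodMk
      ((measurable_finCons N).comp (measurable_snd.prodMk measurable_const)))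
  rw [lintegral_complex (F := fun p => g p *
    rootCount (Fin.cons p.1 (Fin.cons p.2 a : Fin (N + 1) → ℝ) : Fin (N + 2) → ℝ) C)
    (hg.mul ((measurable_rootCount hC).comp hcons))]
  have hcount (c : ℂ) : rootCount (Fin.cons c.re (Fin.cons c.im a : Fin (N + 1) → ℝ) :
      Fin (N + 2) → ℝ) C = ({z ∈ C | linearPart (X ^ 2 * polyOfVec a) z = c}.encard : ENNReal) := by
    rw [rootCount]
    congr 2
    ext z
    refine and_congr_right fun hz => ?_
    rw [linearPart_eq_iff (hC' hz), polyOfVec_cons, polyOfVec_cons]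
    simp only [map_add, map_mul, aeval_C, aeval_X, map_pow, Complex.coe_algebraMap]
    rw [← sub_eq_zero (b := (0 : ℂ)), ← sub_eq_zero (b := (0 : ℂ))]
    ring_nf
  simp_rw [hcount]
  have hdet (z) (hz : z ∈ C) := det_fderiv_linearPart (X ^ 2 * polyOfVec a) (hC' hz)
  have hnn (z) (hz : z ∈ C) : 0 ≤ linearPartJacobian (X ^ 2 * polyOfVec a) z :=
    div_nonneg (Complex.normSq_nonneg _) (hC' hz).le
  have := lintegral_mul_encard_fiber (volume : Measure ℂ) hC
    (f := linearPart (X ^ 2 * polyOfVec a))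
    (fun z hz => (differentiableAt_linearPart _ (hC' hz)).hasFDerivAt.hasFDerivWithinAt) (by
      exact hC.inter (measurableSet_eq_fun
        (ContinuousLinearMap.continuous_det.measurable.comp (measurable_fderiv ℝ _))
        measurable_const)) (hg.comp Complex.measurableEquivRealProd.measurable)
  refine this.trans (setLIntegral_congr_fun hC fun z hz => ?_)
  simp only [hdet z hz, abs_of_nonneg (hnn z hz)]
  rfl

theorem continuous_aeval_derivative_polyOfVec (N : ℕ) :
    Continuous fun p : (Fin N → ℝ) × ℂ => aeval p.2 (derivative (polyOfVec p.1)) := by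
  simp_rw [polyOfVec, derivative_sum, derivative_monomial, map_sum, aeval_monomial]
  simp only [Complex.coe_algebraMap]
  fun_prop

/-- The order of integration matters: the two lowest coordinates go innermost, ready to be replaced
by a root while the others stay fixed. -/
theorem lintegral_finCons_two {E : Type*} [MeasureSpace E] [SigmaFinite (volume : Measure E)]
    {N : ℕ} {F : (Fin (N + 2) → E) → ENNReal} (hF : Measurable F) :
    ∫⁻ a, F a = ∫⁻ a : Fin N → E, ∫⁻ a₀ : E, ∫⁻ a₁ : E,
      F (Fin.cons a₀ (Fin.cons a₁ a : Fin (N + 1) → E)) := by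
  have h1 : Measurable fun p : E × (Fin (N + 1) → E) => F (Fin.cons p.1 p.2) :=
    hF.comp (measurable_finCons (N + 1))
  have h2 : Measurable fun p : (E × (Fin N → E)) × E =>
      F (Fin.cons p.1.1 (Fin.cons p.2 p.1.2 : Fin (N + 1) → E)) :=
    h1.comp ((measurable_fst.comp measurable_fst).prodMk ((measurable_finCons N).comp
      (measurable_snd.prodMk (measurable_snd.comp measurable_fst))))
  have h3 : Measurable fun p : E × (Fin N → E) => ∫⁻ a₁ : E,
      F (Fin.cons p.1 (Fin.cons a₁ p.2 : Fin (N + 1) → E)) := h2.lintegral_prod_right'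
  rw [lintegral_finCons hF, lintegral_lintegral_swap (f := fun (a : Fin N → E) (a₀ : E) =>
    ∫⁻ a₁ : E, F (Fin.cons a₀ (Fin.cons a₁ a : Fin (N + 1) → E)))
    (h3.comp measurable_swap).aemeasurable]
  refine lintegral_congr fun a₀ => ?_
  rw [lintegral_finCons (F := fun a => F (Fin.cons a₀ a))
    (h1.comp (measurable_const.prodMk measurable_id)),
    lintegral_lintegral_swap]
  · exact (h2.comp ((measurable_const.prodMk measurable_snd).prodMk measurable_fst)).aemeasurable

theorem measurable_linearPart (N : ℕ) : Measurable fun p : (Fin N → ℝ) × ℂ =>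
    linearPart (X ^ 2 * polyOfVec p.1) p.2 := by
  have hR : Measurable fun p : (Fin N → ℝ) × ℂ => aeval p.2 (X ^ 2 * polyOfVec p.1) := by
    simp only [map_mul, map_pow, aeval_X]
    exact ((continuous_snd.pow 2).mul (continuous_aeval_polyOfVec N)).measurable
  simp_rw [linearPart_eq]
  generalize hf : (fun p : (Fin N → ℝ) × ℂ => aeval p.2 (X ^ 2 * polyOfVec p.1)) = f at hR
  have hf' (p : (Fin N → ℝ) × ℂ) : aeval p.2 (X ^ 2 * polyOfVec p.1) = f p := by rw [← hf]
  simp_rw [hf']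
  fun_prop

theorem measurable_linearPartJacobian (N : ℕ) : Measurable fun p : (Fin N → ℝ) × ℂ =>
    linearPartJacobian (X ^ 2 * polyOfVec p.1) p.2 := by
  have hR' : Measurable fun p : (Fin N → ℝ) × ℂ =>
      aeval p.2 (derivative (X ^ 2 * polyOfVec p.1)) := by
    simp only [derivative_mul, derivative_X_pow, map_add, map_mul, map_pow, aeval_X, aeval_C]
    exact (((continuous_const.mul (continuous_snd.pow _)).mul (continuous_aeval_polyOfVec N)).add
      ((continuous_snd.pow 2).mul (continuous_aeval_derivative_polyOfVec N))).measurable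
  have hL := measurable_linearPart N
  have hc := Complex.continuous_normSq.measurable
  simp only [linearPartJacobian]
  refine Measurable.div ?_ (by fun_prop)
  exact hc.comp ((Complex.measurable_ofReal.comp (Complex.measurable_im.comp hL)).add hR')

theorem conjQuadratic_mul_polyOfVec_eq {N : ℕ} (z : ℂ) (q : Fin N → ℝ) :
    conjQuadratic z * polyOfVec q = C ((conjQuadratic z * polyOfVec q).coeff 0) +
      C ((conjQuadratic z * polyOfVec q).coeff 1) * X +
        X ^ 2 * polyOfVec fun i : Fin N => (conjQuadratic z * polyOfVec q).coeff (i + 2) := by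
  have hdeg : (conjQuadratic z * polyOfVec q).degree < ((N + 2 : ℕ) : WithBot ℕ) :=
    degree_mul_polyOfVec_lt (r := 2) (degree_conjQuadratic_le z) rfl q
  generalize conjQuadratic z * polyOfVec q = P at hdeg
  ext i
  rcases i with _ | _ | i
  · simp
  · simp [coeff_X_pow_mul', coeff_C]
  · rw [coeff_add, coeff_add, coeff_C_succ, coeff_C_mul, coeff_X, coeff_X_pow_mul,
      coeff_polyOfVec, if_neg (by lia), mul_zero, zero_add, zero_add]
    split_ifs with h
    · rfl
    · exact (degree_lt_iff_coeff_zero _ _).1 hdeg _ (by lia)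

theorem linearPart_conjQuadratic_mul {N : ℕ} {z : ℂ} (hz : 0 < z.im) (q : Fin N → ℝ) :
    linearPart (X ^ 2 * polyOfVec fun i : Fin N => (conjQuadratic z * polyOfVec q).coeff (i + 2)) z =
      ⟨(conjQuadratic z * polyOfVec q).coeff 0, (conjQuadratic z * polyOfVec q).coeff 1⟩ := by
  rw [linearPart_eq_iff hz]
  have := congrArg (aeval z) (conjQuadratic_mul_polyOfVec_eq z q)
  rw [map_add, map_add, map_mul, map_mul, aeval_C, aeval_C, aeval_X, aeval_conjQuadratic, sub_self,
    zero_mul, zero_mul] at this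
  exact this.symm

/-- The numerator is `|G'(z)|²` for `G = (X - z)(X - z̄) q`, and `G'(z) = (z - z̄) q(z) = 2i Im z ·
q(z)`; dividing by `Im z` leaves one factor `Im z`. -/
theorem linearPartJacobian_conjQuadratic_mul {N : ℕ} {z : ℂ} (hz : 0 < z.im) (q : Fin N → ℝ) :
    linearPartJacobian
      (X ^ 2 * polyOfVec fun i : Fin N => (conjQuadratic z * polyOfVec q).coeff (i + 2)) z =
      4 * z.im * ‖aeval z (polyOfVec q)‖ ^ 2 := by
  have h1 : ((conjQuadratic z * polyOfVec q).coeff 1 : ℂ) + aeval z (derivative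
      (X ^ 2 * polyOfVec fun i : Fin N => (conjQuadratic z * polyOfVec q).coeff (i + 2))) =
      2 * z.im * Complex.I * aeval z (polyOfVec q) := by
    have := congrArg (fun p => aeval z (derivative p)) (conjQuadratic_mul_polyOfVec_eq z q)
    simp only [derivative_C, derivative_C_mul, derivative_X, mul_one, map_add,
      aeval_C, Complex.coe_algebraMap, zero_add] at this
    rw [← this, derivative_mul, map_add, map_mul, map_mul, aeval_conjQuadratic, sub_self,
      zero_mul, zero_mul, add_zero]
    congr 1
    simp only [conjQuadratic, derivative_X_pow, derivative_C, map_add, map_sub, map_mul, aeval_C, aeval_X, map_pow]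
    apply Complex.ext <;> simp
  rw [linearPartJacobian, linearPart_conjQuadratic_mul hz]
  simp only
  rw [h1]
  simp only [map_mul, Complex.normSq_ofReal, Complex.normSq_I, Complex.normSq_eq_norm_sq (aeval _ _),
    Complex.normSq_ofNat]
  field_simp
  ring

theorem coeffVec_succ_succ (N : ℕ) (P : ℝ[X]) : coeffVec (N + 2) P =
    Fin.cons (P.coeff 0) (Fin.cons (P.coeff 1) (fun i : Fin N => P.coeff (i + 2)) :
      Fin (N + 1) → ℝ) := by
  ext i
  refine Fin.cases ?_ (fun i => Fin.cases ?_ (fun i => ?_) i) i <;> simp [coeffVec]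

theorem measurable_finCons_two (N : ℕ) : Measurable fun p : (ℝ × ℝ) × (Fin N → ℝ) =>
    (Fin.cons p.1.1 (Fin.cons p.1.2 p.2 : Fin (N + 1) → ℝ) : Fin (N + 2) → ℝ) :=
  (measurable_finCons (N + 1)).comp ((measurable_fst.comp measurable_fst).prodMk
    ((measurable_finCons N).comp ((measurable_snd.comp measurable_fst).prodMk measurable_snd)))

/-- The integrand in the change of variables that trades the two lowest coefficients for a root. -/
def upperRootIntegrand {N : ℕ} (h : (Fin (N + 2) → ℝ) → ENNReal) (a : Fin N → ℝ) (z : ℂ) :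
    ENNReal :=
  ENNReal.ofReal (linearPartJacobian (X ^ 2 * polyOfVec a) z) *
    h (Fin.cons (linearPart (X ^ 2 * polyOfVec a) z).re
      (Fin.cons (linearPart (X ^ 2 * polyOfVec a) z).im a : Fin (N + 1) → ℝ))

theorem measurable_upperRootIntegrand {N : ℕ} {h : (Fin (N + 2) → ℝ) → ENNReal}
    (hh : Measurable h) :
    Measurable fun p : (Fin N → ℝ) × ℂ => upperRootIntegrand h p.1 p.2 := by
  have hL := measurable_linearPart N
  have hP : Measurable fun p : (Fin N → ℝ) × ℂ => (((linearPart (X ^ 2 * polyOfVec p.1) p.2).re,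
      (linearPart (X ^ 2 * polyOfVec p.1) p.2).im), p.1) :=
    ((Complex.measurable_re.comp hL).prodMk (Complex.measurable_im.comp hL)).prodMk measurable_fst
  have hc := (measurable_finCons_two N).comp hP
  exact (measurable_linearPartJacobian N).ennreal_ofReal.mul (hh.comp hc)

theorem lintegral_upperRootIntegrand {N : ℕ} {h : (Fin (N + 2) → ℝ) → ENNReal}
    (hh : Measurable h) {z : ℂ} (hz : 0 < z.im) :
    ∫⁻ a, upperRootIntegrand h a z =
      ∫⁻ q : Fin N → ℝ, h (coeffVec (N + 2) (conjQuadratic z * polyOfVec q)) *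
        ENNReal.ofReal (4 * z.im * ‖aeval z (polyOfVec q)‖ ^ 2) := by
  have hm := (measurable_upperRootIntegrand hh).comp
    (measurable_prodMk_right (α := Fin N → ℝ) (y := z))
  rw [lintegral_coeff_monic_mul (F := fun a => upperRootIntegrand h a z) (monic_conjQuadratic z)
    (natDegree_conjQuadratic z) hm]
  refine lintegral_congr fun q => ?_
  rw [upperRootIntegrand, linearPart_conjQuadratic_mul hz, linearPartJacobian_conjQuadratic_mul hz,
    mul_comm, coeffVec_succ_succ]

/-- The complex counterpart of `lintegral_mul_rootCount_real`. The weight is `2 |z - z̄| |q(z)|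
|q(z̄)|`: the expected Vandermonde and cofactor terms, and the source of one factor 2. -/
theorem lintegral_mul_rootCount_upper {N : ℕ} {h : (Fin (N + 2) → ℝ) → ENNReal}
    (hh : Measurable h) {C : Set ℂ} (hC : MeasurableSet C) (hC' : C ⊆ {z | 0 < z.im}) :
    ∫⁻ a, h a * rootCount a C =
      ∫⁻ z in C, ∫⁻ q : Fin N → ℝ, h (coeffVec (N + 2) (conjQuadratic z * polyOfVec q)) *
        ENNReal.ofReal (4 * z.im * ‖aeval z (polyOfVec q)‖ ^ 2) := by
  rw [lintegral_finCons_two (F := fun a => h a * rootCount a C) (hh.mul (measurable_rootCount hC))]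
  have hinner (a : Fin N → ℝ) : ∫⁻ a₀ : ℝ, ∫⁻ a₁ : ℝ,
      h (Fin.cons a₀ (Fin.cons a₁ a : Fin (N + 1) → ℝ)) *
        rootCount (Fin.cons a₀ (Fin.cons a₁ a : Fin (N + 1) → ℝ) : Fin (N + 2) → ℝ) C =
      ∫⁻ z in C, upperRootIntegrand h a z := lintegral_mul_rootCount_finCons_upper a
    (g := fun p => h (Fin.cons p.1 (Fin.cons p.2 a : Fin (N + 1) → ℝ)))
    (hh.comp ((measurable_finCons_two N).comp (measurable_id.prodMk measurable_const))) hC hC'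
  simp only [hinner]
  rw [lintegral_lintegral_swap (f := fun (a : Fin N → ℝ) (z : ℂ) => upperRootIntegrand h a z)
    (measurable_upperRootIntegrand hh).aemeasurable]
  exact setLIntegral_congr_fun hC fun z hz => lintegral_upperRootIntegrand hh (hC' hz)

/-! ### The Vandermonde factor -/

theorem absVandermonde_nonneg {m : ℕ} (w : Fin m → ℂ) : 0 ≤ absVandermonde w :=
  Finset.prod_nonneg fun _ _ => Finset.prod_nonneg fun _ _ => norm_nonneg _

theorem absVandermonde_cons {m : ℕ} (w₀ : ℂ) (w : Fin m → ℂ) :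
    absVandermonde (Fin.cons w₀ w : Fin (m + 1) → ℂ) = (∏ j, ‖w₀ - w j‖) * absVandermonde w := by
  simp [absVandermonde, Fin.prod_univ_succ, Fin.prod_Ioi_succ]

theorem absVandermonde_append {m n : ℕ} (u : Fin m → ℂ) (v : Fin n → ℂ) :
    absVandermonde (Fin.append u v) =
      absVandermonde u * absVandermonde v * ∏ i, ∏ j, ‖u i - v j‖ := by
  have h (p : ℕ) (w : Fin p → ℂ) :
      absVandermonde w = ∏ i, ∏ j, if i < j then ‖w i - w j‖ else 1 := by
    refine Finset.prod_congr rfl fun i _ => ?_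
    rw [← Finset.prod_filter]
    congr 1
    ext j; simp
  simp only [h, Fin.prod_univ_add, Fin.append_left, Fin.append_right, Finset.prod_mul_distrib]
  have h1 (i j : Fin m) : Fin.castAdd n i < Fin.castAdd n j ↔ i < j := Iff.rfl
  have h2 (i j : Fin n) : Fin.natAdd m i < Fin.natAdd m j ↔ i < j := by
    rw [Fin.lt_def, Fin.lt_def]; simp
  have h3 (i : Fin m) (j : Fin n) : Fin.castAdd n i < Fin.natAdd m j := by
    rw [Fin.lt_def, Fin.val_castAdd, Fin.val_natAdd]; lia
  have h4 (i : Fin n) (j : Fin m) : ¬ Fin.natAdd m i < Fin.castAdd n j := by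
    rw [Fin.lt_def, Fin.val_castAdd, Fin.val_natAdd]; lia
  simp only [h1, h2, h3, h4, if_true, if_false, Finset.prod_const_one]
  ring

theorem absVandermonde_conj {m : ℕ} (w : Fin m → ℂ) :
    absVandermonde (fun i => (starRingEnd ℂ) (w i)) = absVandermonde w := by
  simp only [absVandermonde, ← map_sub, Complex.norm_conj]

/-- The polynomial whose roots are `x`, `z` and `z̄`. -/
def rootPoly {k l : ℕ} (x : Fin k → ℝ) (z : Fin l → ℂ) : ℝ[X] :=
  (∏ i, (X - C (x i))) * ∏ j, conjQuadratic (z j)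

/-- The Jacobian of the parametrization of a polynomial by some of its roots `w` and the
cofactor with coefficients `t`. -/
def rootWeight {m D : ℕ} (w : Fin m → ℂ) (t : Fin D → ℝ) : ℝ :=
  absVandermonde w * ∏ i, ‖aeval (w i) (polyOfVec t)‖

theorem natDegree_rootPoly {k l : ℕ} (x : Fin k → ℝ) (z : Fin l → ℂ) :
    (rootPoly x z).natDegree = k + 2 * l := by
  have h1 := monic_prod_of_monic Finset.univ _ fun i (_ : i ∈ Finset.univ) => monic_X_sub_C (x i)
  have h2 := monic_prod_of_monic Finset.univ _
    fun j (_ : j ∈ Finset.univ) => monic_conjQuadratic (z j)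
  rw [rootPoly, h1.natDegree_mul h2,
    natDegree_prod_of_monic _ _ fun i _ => monic_X_sub_C (x i),
    natDegree_prod_of_monic _ _ fun j _ => monic_conjQuadratic (z j)]
  simp [natDegree_conjQuadratic, mul_comm]

theorem degree_rootPoly_le {k l : ℕ} (x : Fin k → ℝ) (z : Fin l → ℂ) :
    (rootPoly x z).degree ≤ ((k + 2 * l : ℕ) : WithBot ℕ) := by
  rw [← natDegree_rootPoly x z]; exact degree_le_natDegree

theorem conjTuple_zero {k : ℕ} (x : Fin k → ℝ) (z : Fin 0 → ℂ) :
    conjTuple x z = fun i => (x i : ℂ) := by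
  ext i
  rw [conjTuple, show i = Fin.castAdd 0 (Fin.castAdd 0 i) from rfl, Fin.append_left,
    Fin.append_left]
  rfl

/-- The new Vandermonde factors `|x₀ - x_i|` and the new cofactor value `|t(x₀)|` combine into the
value at `x₀` of the cofactor left when only `x₀` has been removed. -/
theorem rootWeight_cons_real {k D : ℕ} (x₀ : ℝ) (x : Fin k → ℝ) (t : Fin D → ℝ) :
    rootWeight (fun i => (((Fin.cons x₀ x : Fin (k + 1) → ℝ) i : ℝ) : ℂ)) t =
      |eval x₀ ((∏ i, (X - C (x i))) * polyOfVec t)| * rootWeight (fun i => (x i : ℂ)) t := by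
  have h : (fun i => (((Fin.cons x₀ x : Fin (k + 1) → ℝ) i : ℝ) : ℂ)) =
      (Fin.cons (x₀ : ℂ) fun i => (x i : ℂ) : Fin (k + 1) → ℂ) := by
    ext i; refine Fin.cases ?_ (fun i => ?_) i <;> simp
  rw [h, rootWeight, rootWeight, absVandermonde_cons, Fin.prod_univ_succ]
  simp only [Fin.cons_zero, Fin.cons_succ, eval_mul, eval_prod, eval_sub, eval_X, eval_C, abs_mul,
    Finset.abs_prod]
  have h1 : ‖aeval (x₀ : ℂ) (polyOfVec t)‖ = |eval x₀ (polyOfVec t)| := by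
    rw [show ((x₀ : ℂ)) = algebraMap ℝ ℂ x₀ from rfl, aeval_algebraMap_apply_eq_algebraMap_eval]
    simp
  have h2 (i : Fin k) : ‖(x₀ : ℂ) - x i‖ = |x₀ - x i| := by
    rw [← Complex.ofReal_sub, Complex.norm_real, Real.norm_eq_abs]
  simp only [h1, h2]
  ring

/-- By conjugation symmetry every distance from `z₀` to another root occurs again for `z̄₀`, which
gives the square. The pair itself contributes `|z₀ - z̄₀| = 2 Im z₀`, and the extra power of 2 makes
this `4 Im z₀`. -/
theorem rootWeight_cons_complex {k l D : ℕ} (x : Fin k → ℝ) {z₀ : ℂ} (hz₀ : 0 < z₀.im)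
    (z : Fin l → ℂ) (t : Fin D → ℝ) :
    2 ^ (l + 1) * rootWeight (conjTuple x (Fin.cons z₀ z : Fin (l + 1) → ℂ)) t =
      4 * z₀.im * ‖aeval z₀ (rootPoly x z * polyOfVec t)‖ ^ 2 *
        (2 ^ l * rootWeight (conjTuple x z) t) := by
  have hself : ‖z₀ - (starRingEnd ℂ) z₀‖ = 2 * z₀.im := by
    rw [Complex.sub_conj]; simp [abs_of_pos hz₀]
  have e1 (i : Fin k) : ‖(x i : ℂ) - (starRingEnd ℂ) z₀‖ = ‖z₀ - x i‖ := by
    rw [← Complex.norm_conj]; simp [norm_sub_rev]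
  have e2 (i : Fin k) : ‖(x i : ℂ) - z₀‖ = ‖z₀ - x i‖ := norm_sub_rev _ _
  have e3 (j : Fin l) : ‖z j - (starRingEnd ℂ) z₀‖ = ‖z₀ - (starRingEnd ℂ) (z j)‖ := by
    rw [← Complex.norm_conj]; simp [norm_sub_rev]
  have e4 (w : ℂ) : ‖aeval ((starRingEnd ℂ) w) (polyOfVec t)‖ = ‖aeval w (polyOfVec t)‖ := by
    rw [aeval_conj, Complex.norm_conj]
  simp only [rootWeight, conjTuple, absVandermonde_append, absVandermonde_conj,
    absVandermonde_cons, Fin.prod_univ_add, Fin.append_left, Fin.append_right, Fin.prod_univ_succ,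
    Fin.cons_zero, Fin.cons_succ, rootPoly, map_mul, map_prod, aeval_conjQuadratic, map_sub,
    aeval_X, aeval_C, Complex.coe_algebraMap, norm_mul, norm_prod, Finset.prod_mul_distrib,
    e1, e2, e3, e4, hself, mul_pow]
  ring

/-! ### Integrating out the factors one by one -/

/-- This is where disjointness enters: a split-off factor does not affect the counts in sets free of
its roots. -/
theorem rootCount_coeffVec_mul {N M : ℕ} {p : ℝ[X]} {q : Fin N → ℝ}
    (hdeg : (p * polyOfVec q).degree < (M : WithBot ℕ)) {B : Set ℂ} (hp : ∀ z ∈ B, aeval z p ≠ 0) :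
    rootCount (coeffVec M (p * polyOfVec q)) B = rootCount q B := by
  rw [rootCount, rootCount, polyOfVec_coeffVec hdeg]
  congr 2
  ext z
  refine and_congr_right fun hz => ?_
  rw [map_mul, mul_eq_zero, or_iff_right (hp z hz)]

theorem setLIntegral_pi_finCons {E : Type*} [MeasureSpace E] [SigmaFinite (volume : Measure E)]
    {k : ℕ} {B : Fin (k + 1) → Set E} (hB : ∀ i, MeasurableSet (B i))
    {F : (Fin (k + 1) → E) → ENNReal} (hF : Measurable F) :
    ∫⁻ x in Set.univ.pi B, F x = ∫⁻ x₀ in B 0, ∫⁻ x in Set.univ.pi fun i => B (Fin.succ i),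
      F (Fin.cons x₀ x) := by
  rw [← lintegral_indicator (MeasurableSet.univ_pi hB),
    lintegral_finCons (hF.indicator (MeasurableSet.univ_pi hB)), ← lintegral_indicator (hB 0)]
  refine lintegral_congr fun x₀ => ?_
  by_cases h0 : x₀ ∈ B 0
  · rw [Set.indicator_of_mem h0, ← lintegral_indicator (MeasurableSet.univ_pi fun i => hB _)]
    refine lintegral_congr fun x => ?_
    have hiff : (Fin.cons x₀ x : Fin (k + 1) → E) ∈ Set.univ.pi B ↔
        x ∈ Set.univ.pi fun i => B (Fin.succ i) := by
      rw [Set.mem_univ_pi, Set.mem_univ_pi, Fin.forall_fin_succ]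
      simp [h0]
    by_cases hx : x ∈ Set.univ.pi fun i => B (Fin.succ i)
    · rw [Set.indicator_of_mem hx, Set.indicator_of_mem (hiff.2 hx)]
    · rw [Set.indicator_of_notMem hx, Set.indicator_of_notMem (mt hiff.1 hx)]
  · rw [Set.indicator_of_notMem h0, ← lintegral_zero (μ := (volume : Measure (Fin k → E)))]
    refine lintegral_congr fun x => ?_
    rw [Set.indicator_of_notMem]
    intro h
    exact h0 (by simpa using h 0 trivial)

/-! ### Measurability in the roots and the cofactor -/

theorem measurable_coeff_mul {β : Type*} [MeasurableSpace β] {p q : β → ℝ[X]}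
    (hp : ∀ i, Measurable fun b => (p b).coeff i) (hq : ∀ i, Measurable fun b => (q b).coeff i)
    (i : ℕ) : Measurable fun b => (p b * q b).coeff i := by
  simp only [coeff_mul]
  exact Finset.measurable_sum _ fun x _ => (hp _).mul (hq _)

theorem measurable_coeff_prod {β ι : Type*} [MeasurableSpace β] (s : Finset ι) {p : ι → β → ℝ[X]}
    (hp : ∀ j i, Measurable fun b => (p j b).coeff i) (i : ℕ) :
    Measurable fun b => (∏ j ∈ s, p j b).coeff i := by
  classical
  induction s using Finset.induction_on generalizing i with
  | empty => simp
  | insert j s hj ih =>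
    simp only [Finset.prod_insert hj]
    exact measurable_coeff_mul (hp j) ih i

theorem measurable_coeff_X_sub_C (i : ℕ) : Measurable fun x : ℝ => (X - C x : ℝ[X]).coeff i := by
  simp only [coeff_sub, coeff_X, coeff_C]
  split_ifs <;> fun_prop

theorem measurable_coeff_conjQuadratic (i : ℕ) :
    Measurable fun z : ℂ => (conjQuadratic z).coeff i := by
  have := Complex.continuous_normSq.measurable
  simp only [conjQuadratic, coeff_add, coeff_sub, coeff_C_mul, coeff_C, coeff_X_pow, coeff_X]
  split_ifs <;> fun_prop

theorem measurable_coeff_rootPoly (k l i : ℕ) :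
    Measurable fun p : (Fin k → ℝ) × (Fin l → ℂ) => (rootPoly p.1 p.2).coeff i := by
  refine measurable_coeff_mul (fun i => measurable_coeff_prod _ (fun j i => ?_) i)
    (fun i => measurable_coeff_prod _ (fun j i => ?_) i) i
  · exact (measurable_coeff_X_sub_C i).comp ((measurable_pi_apply j).comp measurable_fst)
  · exact (measurable_coeff_conjQuadratic i).comp ((measurable_pi_apply j).comp measurable_snd)

theorem continuous_conjTuple (k l : ℕ) :
    Continuous fun p : (Fin k → ℝ) × (Fin l → ℂ) => conjTuple p.1 p.2 := by
  refine continuous_pi fun i => ?_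
  refine Fin.addCases (fun i => Fin.addCases (fun i => ?_) (fun i => ?_) i) (fun i => ?_) i <;>
  · simp only [conjTuple, Fin.append_left, Fin.append_right]
    fun_prop

theorem continuous_absVandermonde (m : ℕ) : Continuous fun w : Fin m → ℂ => absVandermonde w := by
  unfold absVandermonde
  fun_prop

theorem continuous_rootWeight (m D : ℕ) :
    Continuous fun p : (Fin m → ℂ) × (Fin D → ℝ) => rootWeight p.1 p.2 := by
  refine ((continuous_absVandermonde m).comp continuous_fst).mul
    (continuous_finsetProd _ fun i _ => ?_)
  exact ((continuous_aeval_polyOfVec D).comp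
    (continuous_snd.prodMk ((continuous_apply i).comp continuous_fst))).norm

theorem measurable_rootPoly_integrand {N : ℕ} (k l D : ℕ) {h : (Fin N → ℝ) → ENNReal}
    (hh : Measurable h) :
    Measurable fun p : ((Fin k → ℝ) × (Fin l → ℂ)) × (Fin D → ℝ) =>
      h (coeffVec N (rootPoly p.1.1 p.1.2 * polyOfVec p.2)) *
        ENNReal.ofReal (2 ^ l * rootWeight (conjTuple p.1.1 p.1.2) p.2) := by
  refine (hh.comp (measurable_coeffVec_mul (p := fun b : (Fin k → ℝ) × (Fin l → ℂ) =>
    rootPoly b.1 b.2) (measurable_coeff_rootPoly k l) D N)).mul (Measurable.ennreal_ofReal ?_)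
  exact ((continuous_rootWeight _ D).comp
    (((continuous_conjTuple k l).comp continuous_fst).prodMk continuous_snd)).measurable.const_mul _

/-- The integral over the cofactors with `D` coefficients of a function of the polynomial with
roots `x`, `z`, `z̄`, weighted by the Jacobian. -/
def cofactorIntegral {k l N : ℕ} (D : ℕ) (h : (Fin N → ℝ) → ENNReal) (x : Fin k → ℝ)
    (z : Fin l → ℂ) : ENNReal :=
  ∫⁻ t : Fin D → ℝ, h (coeffVec N (rootPoly x z * polyOfVec t)) *
    ENNReal.ofReal (2 ^ l * rootWeight (conjTuple x z) t)

theorem measurable_cofactorIntegral {N : ℕ} (k l D : ℕ) {h : (Fin N → ℝ) → ENNReal}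
    (hh : Measurable h) :
    Measurable fun p : (Fin k → ℝ) × (Fin l → ℂ) => cofactorIntegral D h p.1 p.2 := by
  have := (measurable_rootPoly_integrand k l D hh).lintegral_prod_right'
    (ν := (volume : Measure (Fin D → ℝ)))
  exact this

theorem measurable_coeffVec_mul_polyOfVec (p : ℝ[X]) (N M : ℕ) :
    Measurable fun q : Fin N → ℝ => coeffVec M (p * polyOfVec q) := by
  refine measurable_pi_lambda _ fun i => ?_
  simp only [coeffVec, coeff_mul, coeff_polyOfVec]
  refine Finset.measurable_sum _ fun x _ => ?_
  split_ifs <;> fun_prop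

theorem measurable_prod_X_sub_C_integrand {N : ℕ} (k D : ℕ) {h : (Fin N → ℝ) → ENNReal}
    (hh : Measurable h) :
    Measurable fun p : (Fin k → ℝ) × (Fin D → ℝ) =>
      h (coeffVec N ((∏ i, (X - C (p.1 i))) * polyOfVec p.2)) *
        ENNReal.ofReal (rootWeight (fun i => (p.1 i : ℂ)) p.2) := by
  refine (hh.comp (measurable_coeffVec_mul (p := fun b : Fin k → ℝ => ∏ i, (X - C (b i)))
    (fun i => measurable_coeff_prod _ (fun j i =>
      (measurable_coeff_X_sub_C i).comp (measurable_pi_apply j)) i) D N)).mul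
    (Measurable.ennreal_ofReal ?_)
  have hc : Continuous fun p : (Fin k → ℝ) × (Fin D → ℝ) =>
      ((fun i => (p.1 i : ℂ) : Fin k → ℂ), p.2) := by fun_prop
  exact ((continuous_rootWeight k D).comp hc).measurable

/-- Induction on `k`, splitting off the root in `B 0`. The weight `|q(x₀)|` is absorbed into the
test function, which is why `h` is arbitrary rather than a density. -/
theorem lintegral_mul_prod_rootCount_real {k : ℕ} {B : Fin k → Set ℝ}
    (hB : ∀ i, MeasurableSet (B i)) (hdisj : Pairwise fun i i' => Disjoint (B i) (B i'))
    {N D : ℕ} (hN : N = k + D) {h : (Fin N → ℝ) → ENNReal} (hh : Measurable h) :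
    ∫⁻ a, h a * ∏ i, rootCount a (Complex.ofReal '' B i) =
      ∫⁻ x in Set.univ.pi B, ∫⁻ t : Fin D → ℝ,
        h (coeffVec N ((∏ i, (X - C (x i))) * polyOfVec t)) *
          ENNReal.ofReal (rootWeight (fun i => (x i : ℂ)) t) := by
  induction k generalizing N with
  | zero =>
    obtain rfl : N = D := by lia
    have huniv : Set.univ.pi B = Set.univ := by ext; simp
    rw [huniv, Measure.restrict_univ, Measure.volume_pi_eq_dirac (fun i => Fin.elim0 i),
      lintegral_dirac]
    simp [coeffVec_polyOfVec, rootWeight, absVandermonde]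
  | succ k ih =>
    obtain ⟨N, hNdef, rfl⟩ : ∃ N', N' = k + D ∧ N = N' + 1 := ⟨_, rfl, by lia⟩
    rw [setLIntegral_pi_finCons hB ((measurable_prod_X_sub_C_integrand (k + 1) D
      hh).lintegral_prod_right' (ν := (volume : Measure (Fin D → ℝ))))]
    have hR : Measurable fun a : Fin (N + 1) → ℝ =>
        ∏ i : Fin k, rootCount a (Complex.ofReal '' B i.succ) :=
      Finset.measurable_fun_prod _ fun i _ =>
        measurable_rootCount (measurableSet_ofReal_image (hB _))
    have hstep := lintegral_mul_rootCount_real (h := fun a => h a *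
      ∏ i : Fin k, rootCount a (Complex.ofReal '' B i.succ)) (hh.mul hR) (hB 0)
    have hleft (a : Fin (N + 1) → ℝ) : h a * ∏ i, rootCount a (Complex.ofReal '' B i) =
        h a * (∏ i : Fin k, rootCount a (Complex.ofReal '' B i.succ)) *
          rootCount a (Complex.ofReal '' B 0) := by
      rw [Fin.prod_univ_succ]; ring
    simp only [hleft]
    rw [hstep]
    refine setLIntegral_congr_fun (hB 0) fun x₀ hx₀ => ?_
    have hdeg {d M : ℕ} (hM : M = d + 1) (q : Fin d → ℝ) :
        ((X - C x₀) * polyOfVec q).degree < (M : WithBot ℕ) :=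
      degree_mul_polyOfVec_lt (r := 1) (degree_X_sub_C_le x₀) hM q
    have hcount (q : Fin N → ℝ) (i : Fin k) :
        rootCount (coeffVec (N + 1) ((X - C x₀) * polyOfVec q)) (Complex.ofReal '' B i.succ) =
          rootCount q (Complex.ofReal '' B i.succ) := by
      refine rootCount_coeffVec_mul (hdeg rfl q) ?_
      rintro _ ⟨x, hx, rfl⟩ hzero
      rw [map_sub, aeval_X, aeval_C, Complex.coe_algebraMap, sub_eq_zero, Complex.ofReal_inj]
        at hzero
      exact (Set.disjoint_left.1 (hdisj (Fin.succ_ne_zero i)) hx) (hzero ▸ hx₀)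
    have hmeas : Measurable fun q : Fin N → ℝ =>
        h (coeffVec (N + 1) ((X - C x₀) * polyOfVec q)) *
          ENNReal.ofReal |eval x₀ (polyOfVec q)| := by
      refine Measurable.mul (hh.comp ?_) (Measurable.ennreal_ofReal ?_)
      · exact measurable_coeffVec_mul_polyOfVec _ _ _
      · exact ((continuous_eval_polyOfVec N).comp
          (continuous_id.prodMk continuous_const)).abs.measurable
    have hih := ih (B := fun i => B i.succ) (fun i => hB _)
      (fun i j hij => hdisj (fun h => hij (Fin.succ_injective _ h))) hNdef hmeas
    have hleft' (q : Fin N → ℝ) : h (coeffVec (N + 1) ((X - C x₀) * polyOfVec q)) *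
        (∏ i : Fin k, rootCount (coeffVec (N + 1) ((X - C x₀) * polyOfVec q))
          (Complex.ofReal '' B i.succ)) * ENNReal.ofReal |eval x₀ (polyOfVec q)| =
        h (coeffVec (N + 1) ((X - C x₀) * polyOfVec q)) *
          ENNReal.ofReal |eval x₀ (polyOfVec q)| *
            ∏ i : Fin k, rootCount q (Complex.ofReal '' B i.succ) := by
      simp only [hcount]; ring
    simp only [hleft']
    rw [hih]
    refine lintegral_congr fun x => lintegral_congr fun t => ?_
    have hdeg' : ((∏ i, (X - C (x i))) * polyOfVec t).degree < (N : WithBot ℕ) := by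
      refine degree_mul_polyOfVec_lt (r := k) ?_ (by lia) t
      simp [degree_prod]
    rw [polyOfVec_coeffVec hdeg', rootWeight_cons_real, ENNReal.ofReal_mul (abs_nonneg _),
      Fin.prod_univ_succ]
    simp only [Fin.cons_zero, Fin.cons_succ, mul_assoc]

/-- Integrating a function of a polynomial against the numbers of its roots in disjoint sets. -/
theorem lintegral_mul_prod_rootCount {k l : ℕ} {B : Fin k → Set ℝ} {C : Fin l → Set ℂ}
    (hB : ∀ i, MeasurableSet (B i)) (hdisjB : Pairwise fun i i' => Disjoint (B i) (B i'))
    (hC : ∀ j, MeasurableSet (C j)) (hC' : ∀ j, C j ⊆ {z : ℂ | 0 < z.im})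
    (hdisjC : Pairwise fun j j' => Disjoint (C j) (C j'))
    {N D : ℕ} (hN : N = k + 2 * l + D) {h : (Fin N → ℝ) → ENNReal} (hh : Measurable h) :
    ∫⁻ a, h a * ((∏ i, rootCount a (Complex.ofReal '' B i)) * ∏ j, rootCount a (C j)) =
      ∫⁻ z in Set.univ.pi C, ∫⁻ x in Set.univ.pi B, cofactorIntegral D h x z := by
  induction l generalizing N with
  | zero =>
    have huniv : Set.univ.pi C = Set.univ := by ext; simp
    rw [huniv, Measure.restrict_univ, Measure.volume_pi_eq_dirac (fun i => Fin.elim0 i),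
      lintegral_dirac]
    simp only [cofactorIntegral, rootPoly, conjTuple_zero, Finset.univ_eq_empty, Finset.prod_empty, mul_one,
      pow_zero, one_mul]
    exact lintegral_mul_prod_rootCount_real hB hdisjB (by lia) hh
  | succ l ih =>
    obtain ⟨N, hNdef, rfl⟩ : ∃ N', N' = k + 2 * l + D ∧ N = N' + 2 := ⟨_, rfl, by lia⟩
    have hFm := ((measurable_cofactorIntegral k (l + 1) D hh).comp
      measurable_swap).lintegral_prod_right'
      (ν := (volume : Measure (Fin k → ℝ)).restrict (Set.univ.pi B))
    rw [setLIntegral_pi_finCons hC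
      (F := fun z => ∫⁻ x in Set.univ.pi B, cofactorIntegral D h x z) hFm]
    have hR : Measurable fun a : Fin (N + 2) → ℝ =>
        (∏ i, rootCount a (Complex.ofReal '' B i)) * ∏ j : Fin l, rootCount a (C j.succ) :=
      (Finset.measurable_fun_prod _ fun i _ =>
        measurable_rootCount (measurableSet_ofReal_image (hB _))).mul
      (Finset.measurable_fun_prod _ fun i _ => measurable_rootCount (hC _))
    have hstep := lintegral_mul_rootCount_upper (h := fun a => h a *
      ((∏ i, rootCount a (Complex.ofReal '' B i)) * ∏ j : Fin l, rootCount a (C j.succ)))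
      (hh.mul hR) (hC 0) (hC' 0)
    have hleft (a : Fin (N + 2) → ℝ) :
        h a * ((∏ i, rootCount a (Complex.ofReal '' B i)) * ∏ j, rootCount a (C j)) =
        h a * ((∏ i, rootCount a (Complex.ofReal '' B i)) * ∏ j : Fin l, rootCount a (C j.succ)) *
          rootCount a (C 0) := by
      rw [Fin.prod_univ_succ (fun j => rootCount a (C j))]; ring
    simp only [hleft]
    rw [hstep]
    -- The quadratic factor removes `z₀` and `z̄₀`. Neither is real, `z₀` lies outside the other `C
    -- j` by disjointness, and `z̄₀` lies in the lower half-plane, so the remaining counts are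
    -- unchanged.
    refine setLIntegral_congr_fun (hC 0) fun z₀ hz₀ => ?_
    have hz₀' : 0 < z₀.im := hC' 0 hz₀
    have hdeg (q : Fin N → ℝ) : (conjQuadratic z₀ * polyOfVec q).degree < ((N + 2 : ℕ) : WithBot ℕ) :=
      degree_mul_polyOfVec_lt (r := 2) (degree_conjQuadratic_le z₀) rfl q
    have hcountB (q : Fin N → ℝ) (i : Fin k) :
        rootCount (coeffVec (N + 2) (conjQuadratic z₀ * polyOfVec q)) (Complex.ofReal '' B i) =
          rootCount q (Complex.ofReal '' B i) := by
      refine rootCount_coeffVec_mul (hdeg q) ?_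
      rintro _ ⟨x, hx, rfl⟩ hzero
      rw [aeval_conjQuadratic, mul_eq_zero, sub_eq_zero, sub_eq_zero] at hzero
      rcases hzero with hzero | hzero <;>
      · have := congrArg Complex.im hzero
        simp at this
        linarith
    have hcountC (q : Fin N → ℝ) (j : Fin l) :
        rootCount (coeffVec (N + 2) (conjQuadratic z₀ * polyOfVec q)) (C j.succ) =
          rootCount q (C j.succ) := by
      refine rootCount_coeffVec_mul (hdeg q) fun z hz hzero => ?_
      rw [aeval_conjQuadratic, mul_eq_zero, sub_eq_zero, sub_eq_zero] at hzero
      rcases hzero with hzero | hzero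
      · exact (Set.disjoint_left.1 (hdisjC (Fin.succ_ne_zero j)) hz) (hzero ▸ hz₀)
      · have hzim : 0 < z.im := hC' _ hz
        rw [hzero, Complex.conj_im] at hzim
        linarith
    have hmeas : Measurable fun q : Fin N → ℝ =>
        h (coeffVec (N + 2) (conjQuadratic z₀ * polyOfVec q)) *
          ENNReal.ofReal (4 * z₀.im * ‖aeval z₀ (polyOfVec q)‖ ^ 2) := by
      refine Measurable.mul (hh.comp ?_) (Measurable.ennreal_ofReal ?_)
      · exact measurable_coeffVec_mul_polyOfVec _ _ _
      · exact ((((continuous_aeval_polyOfVec N).comp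
          (continuous_id.prodMk continuous_const)).norm.pow 2).measurable).const_mul _
    have hih := ih (C := fun j => C j.succ) (fun j => hC _) (fun j => hC' _)
      (fun i j hij => hdisjC (fun h => hij (Fin.succ_injective _ h))) hNdef hmeas
    have hleft' (q : Fin N → ℝ) : h (coeffVec (N + 2) (conjQuadratic z₀ * polyOfVec q)) *
        ((∏ i, rootCount (coeffVec (N + 2) (conjQuadratic z₀ * polyOfVec q))
          (Complex.ofReal '' B i)) *
          ∏ j : Fin l, rootCount (coeffVec (N + 2) (conjQuadratic z₀ * polyOfVec q)) (C j.succ)) *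
          ENNReal.ofReal (4 * z₀.im * ‖aeval z₀ (polyOfVec q)‖ ^ 2) =
        h (coeffVec (N + 2) (conjQuadratic z₀ * polyOfVec q)) *
          ENNReal.ofReal (4 * z₀.im * ‖aeval z₀ (polyOfVec q)‖ ^ 2) *
            ((∏ i, rootCount q (Complex.ofReal '' B i)) *
              ∏ j : Fin l, rootCount q (C j.succ)) := by
      simp only [hcountB, hcountC]; ring
    simp only [hleft']
    rw [hih]
    refine lintegral_congr fun z => lintegral_congr fun x => ?_
    rw [cofactorIntegral, cofactorIntegral]
    refine lintegral_congr fun t => ?_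
    have hdeg' : (rootPoly x z * polyOfVec t).degree < (N : WithBot ℕ) :=
      degree_mul_polyOfVec_lt (degree_rootPoly_le x z) (by lia) t
    have hpoly : rootPoly x (Fin.cons z₀ z : Fin (l + 1) → ℂ) * polyOfVec t =
        conjQuadratic z₀ * (rootPoly x z * polyOfVec t) := by
      simp only [rootPoly, Fin.prod_univ_succ, Fin.cons_zero, Fin.cons_succ]; ring
    rw [polyOfVec_coeffVec hdeg', rootWeight_cons_complex x hz₀', hpoly, mul_assoc (h _),
      ENNReal.ofReal_mul (p := 4 * z₀.im * ‖aeval z₀ (rootPoly x z * polyOfVec t)‖ ^ 2)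
        (by positivity)]

/-! ### The law of the coefficients -/

theorem lintegral_prod_apply {n : ℕ} {g : Fin n → ℝ → ENNReal} (hg : ∀ i, Measurable (g i)) :
    ∫⁻ a : Fin n → ℝ, ∏ i, g i (a i) = ∏ i, ∫⁻ t, g i t := by
  induction n with
  | zero =>
    rw [Measure.volume_pi_eq_dirac (fun i => Fin.elim0 i), lintegral_dirac]
    simp
  | succ n ih =>
    have hm : Measurable fun a : Fin (n + 1) → ℝ => ∏ i, g i (a i) :=
      Finset.measurable_fun_prod _ fun i _ => (hg i).comp (measurable_pi_apply i)
    have hm' : Measurable fun a : Fin n → ℝ => ∏ i : Fin n, g i.succ (a i) :=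
      Finset.measurable_fun_prod _ fun i _ => (hg _).comp (measurable_pi_apply i)
    rw [lintegral_finCons hm]
    simp only [Fin.prod_univ_succ, Fin.cons_zero, Fin.cons_succ]
    simp_rw [lintegral_const_mul _ hm', ih fun i => hg i.succ]
    rw [lintegral_mul_const _ (hg 0)]

theorem pi_withDensity {n : ℕ} {g : Fin n → ℝ → ENNReal} (hg : ∀ i, Measurable (g i))
    [∀ i, SigmaFinite ((volume : Measure ℝ).withDensity (g i))] :
    Measure.pi (fun i => (volume : Measure ℝ).withDensity (g i)) =
      (volume : Measure (Fin n → ℝ)).withDensity fun a => ∏ i, g i (a i) := by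
  refine Measure.pi_eq fun s hs => ?_
  rw [withDensity_apply _ (MeasurableSet.univ_pi hs), ← lintegral_indicator (MeasurableSet.univ_pi hs)]
  have h (a : Fin n → ℝ) : (Set.univ.pi s).indicator (fun a => ∏ i, g i (a i)) a =
      ∏ i, (s i).indicator (g i) (a i) := by
    by_cases ha : a ∈ Set.univ.pi s
    · rw [Set.indicator_of_mem ha]
      exact Finset.prod_congr rfl fun i _ => (Set.indicator_of_mem (ha i trivial) _).symm
    · rw [Set.indicator_of_notMem ha]
      obtain ⟨i, hi⟩ : ∃ i, a i ∉ s i := by simpa using ha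
      exact (Finset.prod_eq_zero (Finset.mem_univ i) (Set.indicator_of_notMem hi _)).symm
  simp_rw [h]
  rw [lintegral_prod_apply fun i => (hg i).indicator (hs i)]
  refine Finset.prod_congr rfl fun i _ => ?_
  rw [lintegral_indicator (hs i), withDensity_apply _ (hs i)]

/-- The joint density of the coefficients. -/
def jointDensity {n : ℕ} (f : Fin n → ℝ → ℝ) (a : Fin n → ℝ) : ENNReal :=
  ∏ i, ENNReal.ofReal (f i (a i))

theorem measurable_jointDensity {n : ℕ} {f : Fin n → ℝ → ℝ} (hf : ∀ i, Measurable (f i)) :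
    Measurable (jointDensity f) :=
  Finset.measurable_fun_prod _ fun i _ => ((hf i).comp (measurable_pi_apply i)).ennreal_ofReal

theorem map_eq_withDensity_jointDensity {Ω : Type*} [MeasurableSpace Ω] {P : Measure Ω}
    [IsProbabilityMeasure P] {n : ℕ} {ξ : Fin n → Ω → ℝ} {f : Fin n → ℝ → ℝ}
    (hξ : ∀ i, Measurable (ξ i)) (hindep : iIndepFun ξ P) (hf : ∀ i, Measurable (f i))
    (hdens : ∀ i, P.map (ξ i) = volume.withDensity (fun t => ENNReal.ofReal (f i t))) :
    P.map (fun ω i => ξ i ω) = volume.withDensity (jointDensity f) := by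
  rw [(iIndepFun_iff_map_fun_eq_pi_map fun i => (hξ i).aemeasurable).1 hindep]
  have hprob (i : Fin n) :
      IsProbabilityMeasure (volume.withDensity (fun t => ENNReal.ofReal (f i t))) := by
    rw [← hdens i]
    exact Measure.isProbabilityMeasure_map (hξ i).aemeasurable
  simp_rw [hdens]
  exact pi_withDensity (g := fun i t => ENNReal.ofReal (f i t)) fun i => (hf i).ennreal_ofReal

/-! ### Translation of the definitions -/

theorem polyFun_eq_aeval {n : ℕ} (a : Fin (n + 1) → ℝ) (z : ℂ) :
    polyFun a z = aeval z (polyOfVec a) := by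
  rw [aeval_polyOfVec, polyFun]

theorem zeroMeasure_apply {n : ℕ} (a : Fin (n + 1) → ℝ) {B : Set ℂ} (hB : MeasurableSet B) :
    zeroMeasure a B = rootCount a B := by
  rw [zeroMeasure, Measure.sum_apply _ hB, rootCount, ← ENNReal.tsum_set_one]
  simp_rw [Measure.dirac_apply' _ hB]
  refine (tsum_subtype {z | polyFun a z = 0} (B.indicator (1 : ℂ → ENNReal))).trans ?_
  rw [tsum_subtype {z | z ∈ B ∧ aeval z (polyOfVec a) = 0} (fun _ => (1 : ENNReal))]
  refine tsum_congr fun z => ?_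
  rw [Set.indicator_indicator]
  have : {z | polyFun a z = 0} ∩ B = {z | z ∈ B ∧ aeval z (polyOfVec a) = 0} := by
    ext z
    rw [Set.mem_inter_iff, and_comm, Set.mem_ofPred_eq, Set.mem_ofPred_eq, polyFun_eq_aeval]
  rw [this]
  rfl

theorem map_rootPoly {k l : ℕ} (x : Fin k → ℝ) (z : Fin l → ℂ) :
    (rootPoly x z).map (algebraMap ℝ ℂ) = ∏ i, (X - C (conjTuple x z i)) := by
  simp only [rootPoly, Polynomial.map_mul, Polynomial.map_prod, map_conjQuadratic,
    Fin.prod_univ_add, conjTuple, Fin.append_left, Fin.append_right, Polynomial.map_sub, map_X,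
    map_C, Finset.prod_mul_distrib, mul_assoc, Complex.coe_algebraMap]

/-- Vieta's formula with its boundary conventions: `i - j > m` corresponds to a negative index of
`σ` and `j > i` to an index above `m`, so both sides vanish in these cases. -/
theorem coeff_prod_X_sub_C_eq_elemSymm {m : ℕ} (w : Fin m → ℂ) (i j : ℕ) :
    (if j ≤ i then (∏ r, (X - C (w r))).coeff (i - j) else 0) =
      (-1 : ℂ) ^ ((m : ℤ) - i + j) * elemSymm w ((m : ℤ) - i + j) := by
  have hprod : ∏ r, (X - C (w r)) = ((Finset.univ.val.map w).map fun r => X - C r).prod := by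
    rw [Multiset.map_map]; rfl
  have hcard : Multiset.card (Finset.univ.val.map w) = m := by simp
  split_ifs with hij
  · by_cases hm : i - j ≤ m
    · have hz : (m : ℤ) - i + j = ((m - (i - j) : ℕ) : ℤ) := by lia
      rw [hprod, Multiset.prod_X_sub_C_coeff _ (by rw [hcard]; exact hm), hcard,
        Finset.esymm_map_val, hz, zpow_natCast, elemSymm, if_neg (by lia), Int.toNat_natCast]
    · rw [elemSymm, if_pos (by lia), mul_zero]
      refine coeff_eq_zero_of_natDegree_lt ?_
      rw [natDegree_prod_of_monic _ _ fun r _ => monic_X_sub_C (w r)]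
      simp; lia
  · rw [elemSymm, if_neg (by lia), Finset.powersetCard_eq_empty.2, Finset.sum_empty, mul_zero]
    simp; lia

/-- The monic polynomial with roots `x, z, z̄` is real, so taking real parts in `rhoCoeff` loses
nothing, and Vieta identifies the sum over `j` with a convolution of coefficients. -/
theorem rhoCoeff_conjTuple {n k l : ℕ} (x : Fin k → ℝ) (z : Fin l → ℂ)
    (t : Fin (n - (k + l + l) + 1) → ℝ) (i : Fin (n + 1)) :
    rhoCoeff n (conjTuple x z) t i = (rootPoly x z * polyOfVec t).coeff i := by
  rw [rhoCoeff, polyOfVec, Finset.mul_sum, finsetSum_coeff]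
  refine Finset.sum_congr rfl fun j _ => ?_
  have h := coeff_prod_X_sub_C_eq_elemSymm (conjTuple x z) i j
  rw [← map_rootPoly, coeff_map] at h
  have h' := congrArg Complex.re h
  rw [show (-1 : ℂ) = ((-1 : ℝ) : ℂ) by simp, ← Complex.ofReal_zpow, Complex.re_ofReal_mul] at h'
  rw [← h', ← C_mul_X_pow_eq_monomial, mul_left_comm, coeff_C_mul, coeff_mul_X_pow', mul_comm]
  split_ifs <;> simp

theorem rhoIntegrand_nonneg {n m : ℕ} {f : Fin (n + 1) → ℝ → ℝ} (hf0 : ∀ i t, 0 ≤ f i t)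
    (w : Fin m → ℂ) (t : Fin (n - m + 1) → ℝ) : 0 ≤ rhoIntegrand f w t :=
  mul_nonneg (Finset.prod_nonneg fun _ _ => hf0 _ _) (Finset.prod_nonneg fun _ _ => norm_nonneg _)

theorem measurable_rhoIntegrand {n m : ℕ} {f : Fin (n + 1) → ℝ → ℝ} (hf : ∀ i, Measurable (f i))
    (w : Fin m → ℂ) : Measurable (rhoIntegrand f w) := by
  refine Measurable.mul (Finset.measurable_fun_prod _ fun i _ => (hf i).comp ?_) ?_
  · unfold rhoCoeff; fun_prop
  · fun_prop

theorem cofactorIntegral_jointDensity {n k l : ℕ} {f : Fin (n + 1) → ℝ → ℝ}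
    (hf : ∀ i, Measurable (f i)) (hf0 : ∀ i t, 0 ≤ f i t) (x : Fin k → ℝ) (z : Fin l → ℂ) :
    cofactorIntegral (n - (k + l + l) + 1) (jointDensity f) x z =
      ENNReal.ofReal (2 ^ l * absVandermonde (conjTuple x z)) *
        ∫⁻ t, ENNReal.ofReal (rhoIntegrand f (conjTuple x z) t) := by
  rw [cofactorIntegral, ← lintegral_const_mul _ (measurable_rhoIntegrand hf _).ennreal_ofReal]
  refine lintegral_congr fun t => ?_
  have h0 := absVandermonde_nonneg (conjTuple x z)
  rw [jointDensity, ← ENNReal.ofReal_prod_of_nonneg fun i _ => hf0 _ _,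
    ← ENNReal.ofReal_mul (Finset.prod_nonneg fun i _ => hf0 _ _), ← ENNReal.ofReal_mul (by positivity)]
  congr 1
  simp only [rhoIntegrand, rhoCoeff_conjTuple, rootWeight, aeval_polyOfVec, coeffVec]
  ring

/-- No convergence is needed: a divergent Bochner integral is 0, and so is `(⊤ : ENNReal).toReal`.
-/
theorem toReal_cofactorIntegral_jointDensity {n k l : ℕ} {f : Fin (n + 1) → ℝ → ℝ}
    (hf : ∀ i, Measurable (f i)) (hf0 : ∀ i t, 0 ≤ f i t) (x : Fin k → ℝ) (z : Fin l → ℂ) :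
    (cofactorIntegral (n - (k + l + l) + 1) (jointDensity f) x z).toReal =
      2 ^ l * rho f (conjTuple x z) := by
  have h0 := absVandermonde_nonneg (conjTuple x z)
  rw [cofactorIntegral_jointDensity hf hf0, ENNReal.toReal_mul, ENNReal.toReal_ofReal (by positivity),
    rho, integral_eq_lintegral_of_nonneg_ae (Filter.Eventually.of_forall
      (rhoIntegrand_nonneg hf0 _)) (measurable_rhoIntegrand hf _).aestronglyMeasurable, mul_assoc]

/-- A vanishing Vandermonde factor would hide divergence, since `0 * ⊤ = 0`; hence the condition
`hV`. -/
theorem integrable_rhoIntegrand {n k l : ℕ} {f : Fin (n + 1) → ℝ → ℝ}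
    (hf : ∀ i, Measurable (f i)) (hf0 : ∀ i t, 0 ≤ f i t) {x : Fin k → ℝ} {z : Fin l → ℂ}
    (hV : absVandermonde (conjTuple x z) ≠ 0)
    (hfin : cofactorIntegral (n - (k + l + l) + 1) (jointDensity f) x z < ⊤) :
    Integrable (rhoIntegrand f (conjTuple x z)) := by
  have h0 : 0 < absVandermonde (conjTuple x z) := (absVandermonde_nonneg _).lt_of_ne' hV
  rw [cofactorIntegral_jointDensity hf hf0] at hfin
  refine ⟨(measurable_rhoIntegrand hf _).aestronglyMeasurable, ?_⟩
  rw [hasFiniteIntegral_iff_ofReal (Filter.Eventually.of_forall (rhoIntegrand_nonneg hf0 _))]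
  exact ENNReal.lt_top_of_mul_ne_top_right hfin.ne (by simpa using by positivity)

/-! ### Reduction to products of disjoint sets -/

/-- For `i ≠ j` the coincidence set `x i = x j` is a proper linear subspace, hence null. -/
theorem ae_injective_pi (E : Type*) [NormedAddCommGroup E] [NormedSpace ℝ E]
    [FiniteDimensional ℝ E] [Nontrivial E] [MeasureSpace E] [BorelSpace E]
    [(volume : Measure E).IsAddHaarMeasure] (k : ℕ) :
    ∀ᵐ x : Fin k → E, Function.Injective x := by
  have h (i j : Fin k) : ∀ᵐ x : Fin k → E, x i = x j → i = j := by
    by_cases hij : i = j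
    · simp [hij]
    simp only [hij, imp_false]
    let V : Submodule ℝ (Fin k → E) :=
      LinearMap.ker (LinearMap.proj (R := ℝ) (φ := fun _ : Fin k => E) i - LinearMap.proj j)
    have hV : V ≠ ⊤ := by
      obtain ⟨e, he⟩ := exists_ne (0 : E)
      intro htop
      have hmem : (Pi.single i e : Fin k → E) ∈ V := htop ▸ Submodule.mem_top
      rw [LinearMap.mem_ker] at hmem
      simp [Pi.single_eq_of_ne (Ne.symm hij)] at hmem
      exact he hmem
    have h0 := Measure.addHaar_submodule (volume : Measure (Fin k → E)) V hV
    refine measure_mono_null (fun x hx => ?_) h0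
    have hx' : x i = x j := by simpa using hx
    simp [V, hx']
  have h' : ∀ᵐ x : Fin k → E, ∀ i j, x i = x j → i = j :=
    ae_all_iff.2 fun i => ae_all_iff.2 fun j => h i j
  filter_upwards [h'] with x hx i j hij using hx i j hij

theorem exists_disjoint_basis_of_injective {X : Type*} [TopologicalSpace X] [T2Space X]
    [SecondCountableTopology X] {k : ℕ} {x : Fin k → X} (hx : Function.Injective x) {U : Set X}
    (hU : IsOpen U) (hxU : ∀ i, x i ∈ U) :
    ∃ B : Fin k → TopologicalSpace.countableBasis X, (∀ i, x i ∈ (B i : Set X)) ∧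
      (∀ i, (B i : Set X) ⊆ U) ∧
      Pairwise fun i i' => Disjoint (B i : Set X) (B i') := by
  obtain ⟨V, hV, hdisj⟩ := (Set.finite_range x).t2_separation
  have h (i : Fin k) : ∃ b ∈ TopologicalSpace.countableBasis X, x i ∈ b ∧ b ⊆ V (x i) ∩ U :=
    (TopologicalSpace.isBasis_countableBasis X).exists_subset_of_mem_open
      ⟨(hV (x i)).1, hxU i⟩ ((hV (x i)).2.inter hU)
  choose b hb hxb hbV using h
  refine ⟨fun i => ⟨b i, hb i⟩, hxb, fun i => (hbV i).trans Set.inter_subset_right, ?_⟩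
  intro i i' hii'
  exact (hdisj (Set.mem_range_self i) (Set.mem_range_self i') (hx.ne hii')).mono
    ((hbV i).trans Set.inter_subset_left) ((hbV i').trans Set.inter_subset_left)

theorem measurableSet_upperConfig (k l : ℕ) : MeasurableSet (upperConfig k l) := by
  simp only [upperConfig, Set.ofPred_forall]
  exact MeasurableSet.iInter fun j => measurableSet_lt measurable_const
    (Complex.measurable_im.comp ((measurable_pi_apply j).comp measurable_snd))

theorem isOpen_upperHalfPlane : IsOpen {z : ℂ | 0 < z.im} :=
  isOpen_lt continuous_const Complex.continuous_im

theorem ae_injective_prod (k l : ℕ) : ∀ᵐ p : (Fin k → ℝ) × (Fin l → ℂ),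
    Function.Injective p.1 ∧ Function.Injective p.2 :=
  (Measure.quasiMeasurePreserving_fst.ae (ae_injective_pi ℝ k)).and
    (Measure.quasiMeasurePreserving_snd.ae (ae_injective_pi ℂ l))

/-- A configuration with distinct points lies in a product of pairwise disjoint basic open sets.
There are countably many such products, and configurations with coincidences are null. -/
theorem ae_upperConfig_of_ae_pi {k l : ℕ} {G : (Fin k → ℝ) × (Fin l → ℂ) → Prop}
    (hG : ∀ (B : Fin k → Set ℝ) (C : Fin l → Set ℂ), (∀ i, MeasurableSet (B i)) →
      (∀ j, MeasurableSet (C j)) → (∀ j, C j ⊆ {z : ℂ | 0 < z.im}) →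
      Pairwise (fun i i' => Disjoint (B i) (B i')) → Pairwise (fun j j' => Disjoint (C j) (C j')) →
      ∀ᵐ p ∂(volume.restrict (Set.univ.pi B ×ˢ Set.univ.pi C)), G p) :
    ∀ᵐ p ∂(volume.restrict (upperConfig k l)), G p := by
  rw [ae_restrict_iff' (measurableSet_upperConfig k l)]
  have hcount : ∀ᵐ p : (Fin k → ℝ) × (Fin l → ℂ),
      ∀ (B : Fin k → TopologicalSpace.countableBasis ℝ)
        (C : Fin l → TopologicalSpace.countableBasis ℂ),
      (∀ j, (C j : Set ℂ) ⊆ {z : ℂ | 0 < z.im}) →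
      Pairwise (fun i i' => Disjoint (B i : Set ℝ) (B i')) →
      Pairwise (fun j j' => Disjoint (C j : Set ℂ) (C j')) →
      p ∈ (Set.univ.pi fun i => (B i : Set ℝ)) ×ˢ (Set.univ.pi fun j => (C j : Set ℂ)) → G p := by
    have := (TopologicalSpace.countable_countableBasis ℝ).to_subtype
    have := (TopologicalSpace.countable_countableBasis ℂ).to_subtype
    refine ae_all_iff.2 fun B => ae_all_iff.2 fun C => ?_
    simp only [Filter.eventually_imp_distrib_left]
    intro hC hBd hCd
    have hBm (i) : MeasurableSet (B i : Set ℝ) :=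
      (TopologicalSpace.isOpen_of_mem_countableBasis (B i).2).measurableSet
    have hCm (j) : MeasurableSet (C j : Set ℂ) :=
      (TopologicalSpace.isOpen_of_mem_countableBasis (C j).2).measurableSet
    exact (ae_restrict_iff' ((MeasurableSet.univ_pi hBm).prod (MeasurableSet.univ_pi hCm))).1
      (hG _ _ hBm hCm hC hBd hCd)
  filter_upwards [hcount, ae_injective_prod k l] with p hp hinj hpU
  obtain ⟨B, hB, -, hBd⟩ := exists_disjoint_basis_of_injective hinj.1 isOpen_univ fun _ => trivial
  obtain ⟨C, hC, hCU, hCd⟩ := exists_disjoint_basis_of_injective hinj.2 isOpen_upperHalfPlane hpU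
  exact hp B C hCU hBd hCd ⟨fun i _ => hB i, fun j _ => hC j⟩

theorem measure_ext_pi_prod {k l : ℕ} {μ ν : Measure ((Fin k → ℝ) × (Fin l → ℂ))}
    [IsFiniteMeasure μ] (h : ∀ (B : Fin k → Set ℝ) (C : Fin l → Set ℂ), (∀ i, MeasurableSet (B i)) →
      (∀ j, MeasurableSet (C j)) → μ (Set.univ.pi B ×ˢ Set.univ.pi C) =
        ν (Set.univ.pi B ×ˢ Set.univ.pi C)) : μ = ν := by
  have hspan {ι : Type} {E : Type} [MeasurableSpace E] : IsCountablySpanning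
      (Set.univ.pi '' Set.univ.pi fun _ : ι => {s : Set E | MeasurableSet s}) :=
    ⟨fun _ => Set.univ, fun _ => ⟨fun _ => Set.univ, fun _ _ => MeasurableSet.univ,
      Set.pi_univ _⟩, Set.iUnion_const _⟩
  refine ext_of_generate_finite _ (generateFrom_eq_prod generateFrom_pi generateFrom_pi hspan
    hspan).symm (isPiSystem_pi.prod isPiSystem_pi) ?_ ?_
  · rintro _ ⟨_, ⟨B, hB, rfl⟩, _, ⟨C, hC, rfl⟩, rfl⟩
    exact h B C (fun i => hB i trivial) fun j => hC j trivial
  · simpa using h (fun _ => Set.univ) (fun _ => Set.univ) (fun _ => MeasurableSet.univ)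
      fun _ => MeasurableSet.univ

/-- Mixed correlation functions are unique up to a null set. -/
theorem IsMixedCorrelation.ae_eq {Ω : Type*} [MeasurableSpace Ω] {P : Measure Ω} {n : ℕ}
    {ξ : Fin (n + 1) → Ω → ℝ} {k l : ℕ} {r r' : (Fin k → ℝ) → (Fin l → ℂ) → ℝ}
    (hr : IsMixedCorrelation P ξ k l r) (hr' : IsMixedCorrelation P ξ k l r') :
    ∀ᵐ p ∂(volume.restrict (upperConfig k l)), r p.1 p.2 = r' p.1 p.2 := by
  refine ae_upperConfig_of_ae_pi fun B C hB hC hCU hBd hCd => ?_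
  set S := Set.univ.pi B ×ˢ Set.univ.pi C with hSdef
  have hS : MeasurableSet S := (MeasurableSet.univ_pi hB).prod (MeasurableSet.univ_pi hC)
  have hSU : S ⊆ upperConfig k l := fun p hp j => hCU j (hp.2 j trivial)
  have hnn {s : (Fin k → ℝ) → (Fin l → ℂ) → ℝ} (hs : IsMixedCorrelation P ξ k l s) {T}
      (hT : MeasurableSet T) (hTS : T ⊆ S) : 0 ≤ᵐ[volume.restrict T] fun p => s p.1 p.2 :=
    (ae_restrict_iff' hT).2 (Filter.Eventually.of_forall fun p hp => hs.nonneg p (hSU (hTS hp)))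
  have hint {s : (Fin k → ℝ) → (Fin l → ℂ) → ℝ} (hs : IsMixedCorrelation P ξ k l s) :
      IntegrableOn (fun p : (Fin k → ℝ) × (Fin l → ℂ) => s p.1 p.2) S :=
    (hs.correlation B C hB hC hCU hBd hCd).2.1
  have hfin {s : (Fin k → ℝ) → (Fin l → ℂ) → ℝ} (hs : IsMixedCorrelation P ξ k l s) :
      ∫⁻ p in S, ENNReal.ofReal (s p.1 p.2) ≠ ⊤ := (hint hs).lintegral_lt_top.ne
  have hmeas {s : (Fin k → ℝ) → (Fin l → ℂ) → ℝ} (hs : IsMixedCorrelation P ξ k l s) :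
      AEMeasurable (fun p : (Fin k → ℝ) × (Fin l → ℂ) => ENNReal.ofReal (s p.1 p.2))
        (volume.restrict S) := (hint hs).aestronglyMeasurable.aemeasurable.ennreal_ofReal
  -- Intersecting an arbitrary box with the fixed disjoint sets keeps disjointness, so the defining
  -- identity applies to every box. The right side does not involve `s`, so both densities give the
  -- same measure on boxes.
  have hval {s : (Fin k → ℝ) → (Fin l → ℂ) → ℝ} (hs : IsMixedCorrelation P ξ k l s)
      (B' : Fin k → Set ℝ) (C' : Fin l → Set ℂ) (hB' : ∀ i, MeasurableSet (B' i))
      (hC' : ∀ j, MeasurableSet (C' j)) :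
      (volume.restrict S).withDensity (fun p => ENNReal.ofReal (s p.1 p.2))
        (Set.univ.pi B' ×ˢ Set.univ.pi C') =
      ENNReal.ofReal (∫ ω, (∏ i, (zeroMeasure fun q => ξ q ω).real
        (Complex.ofReal '' (B' i ∩ B i))) *
          ∏ j, (zeroMeasure fun q => ξ q ω).real (C' j ∩ C j) ∂P) := by
    have hR : MeasurableSet (Set.univ.pi B' ×ˢ Set.univ.pi C') :=
      (MeasurableSet.univ_pi hB').prod (MeasurableSet.univ_pi hC')
    obtain ⟨-, h2, h3⟩ := hs.correlation (fun i => B' i ∩ B i) (fun j => C' j ∩ C j)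
      (fun i => (hB' i).inter (hB i)) (fun j => (hC' j).inter (hC j))
      (fun j => Set.inter_subset_right.trans (hCU j))
      (fun i i' h => (hBd h).mono Set.inter_subset_right Set.inter_subset_right)
      (fun i i' h => (hCd h).mono Set.inter_subset_right Set.inter_subset_right)
    have hinter : (Set.univ.pi B' ×ˢ Set.univ.pi C') ∩ S =
        (Set.univ.pi fun i => B' i ∩ B i) ×ˢ Set.univ.pi fun j => C' j ∩ C j := by
      rw [hSdef, Set.prod_inter_prod, ← Set.pi_inter_distrib, ← Set.pi_inter_distrib]
    rw [withDensity_apply _ hR, Measure.restrict_restrict hR, h3, ← hinter]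
    rw [← hinter] at h2
    exact (ofReal_integral_eq_lintegral_ofReal h2
      (hnn hs (hR.inter hS) Set.inter_subset_right)).symm
  have hfinm : IsFiniteMeasure ((volume.restrict S).withDensity
      fun p => ENNReal.ofReal (r p.1 p.2)) := isFiniteMeasure_withDensity (hfin hr)
  have heq : (volume.restrict S).withDensity (fun p => ENNReal.ofReal (r p.1 p.2)) =
      (volume.restrict S).withDensity (fun p => ENNReal.ofReal (r' p.1 p.2)) :=
    measure_ext_pi_prod fun B' C' hB' hC' => by
      rw [hval hr B' C' hB' hC', hval hr' B' C' hB' hC']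
  filter_upwards [(withDensity_eq_iff (hmeas hr) (hmeas hr') (hfin hr)).1 heq,
    hnn hr hS subset_rfl, hnn hr' hS subset_rfl] with p hp h1 h2
  exact (ENNReal.ofReal_eq_ofReal_iff h1 h2).1 hp

/-! ### Nonvanishing of the Vandermonde factor -/

theorem absVandermonde_ne_zero {m : ℕ} {w : Fin m → ℂ} (hw : Function.Injective w) :
    absVandermonde w ≠ 0 := by
  refine Finset.prod_ne_zero_iff.2 fun i _ => Finset.prod_ne_zero_iff.2 fun j hj => ?_
  rw [norm_ne_zero_iff, sub_ne_zero]
  exact hw.ne (Finset.mem_Ioi.1 hj).ne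

theorem absVandermonde_conjTuple_ne_zero {k l : ℕ} {x : Fin k → ℝ} {z : Fin l → ℂ}
    (hx : Function.Injective x) (hz : Function.Injective z) (hzU : ∀ j, 0 < (z j).im) :
    absVandermonde (conjTuple x z) ≠ 0 := by
  have hne (c : ℂ) (j : Fin l) (hc : 0 ≤ c.im) : c - (starRingEnd ℂ) (z j) ≠ 0 := by
    intro h
    have := congrArg Complex.im h
    simp at this
    linarith [hzU j]
  rw [conjTuple, absVandermonde_append, absVandermonde_append, absVandermonde_conj]
  refine mul_ne_zero (mul_ne_zero (mul_ne_zero (mul_ne_zero ?_ ?_) ?_) ?_) ?_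
  · exact absVandermonde_ne_zero (Complex.ofReal_injective.comp hx)
  · exact absVandermonde_ne_zero hz
  · refine Finset.prod_ne_zero_iff.2 fun i _ => Finset.prod_ne_zero_iff.2 fun j _ => ?_
    rw [norm_ne_zero_iff, sub_ne_zero]
    intro h
    have := congrArg Complex.im h
    simp at this
    linarith [hzU j]
  · exact absVandermonde_ne_zero hz
  · refine Finset.prod_ne_zero_iff.2 fun i _ => Finset.prod_ne_zero_iff.2 fun j _ => ?_
    rw [norm_ne_zero_iff]
    refine Fin.addCases (fun i => ?_) (fun i => ?_) i
    · rw [Fin.append_left]; exact hne _ j (by simp)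
    · rw [Fin.append_right]; exact hne _ j (hzU i).le

/-! ### The correlation functions -/

section Main

variable {Ω : Type*} [MeasurableSpace Ω] {P : Measure Ω} [IsProbabilityMeasure P]
  {n : ℕ} {ξ : Fin (n + 1) → Ω → ℝ} {f : Fin (n + 1) → ℝ → ℝ}

theorem lintegral_comp_coefficients (hξ : ∀ i, Measurable (ξ i)) (hindep : iIndepFun ξ P)
    (hf : ∀ i, Measurable (f i))
    (hdens : ∀ i, P.map (ξ i) = volume.withDensity (fun t => ENNReal.ofReal (f i t)))
    {H : (Fin (n + 1) → ℝ) → ENNReal} (hH : Measurable H) :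
    ∫⁻ ω, H (fun i => ξ i ω) ∂P = ∫⁻ a, jointDensity f a * H a := by
  rw [← lintegral_map hH (measurable_pi_lambda _ hξ),
    map_eq_withDensity_jointDensity hξ hindep hf hdens,
    lintegral_withDensity_eq_lintegral_mul _ (measurable_jointDensity hf) hH]
  rfl

theorem ae_coefficients_ne_zero (hξ : ∀ i, Measurable (ξ i)) (hindep : iIndepFun ξ P)
    (hf : ∀ i, Measurable (f i))
    (hdens : ∀ i, P.map (ξ i) = volume.withDensity (fun t => ENNReal.ofReal (f i t))) :
    ∀ᵐ ω ∂P, (fun i => ξ i ω) ≠ 0 := by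
  have h : ∀ᵐ a ∂(P.map fun ω i => ξ i ω), a ≠ 0 := by
    rw [map_eq_withDensity_jointDensity hξ hindep hf hdens]
    exact withDensity_absolutelyContinuous _ _ (Measure.ae_ne volume 0)
  exact ae_of_ae_map (measurable_pi_lambda _ hξ).aemeasurable h

theorem lintegral_prod_zeroMeasure (hξ : ∀ i, Measurable (ξ i)) (hindep : iIndepFun ξ P)
    (hf : ∀ i, Measurable (f i))
    (hdens : ∀ i, P.map (ξ i) = volume.withDensity (fun t => ENNReal.ofReal (f i t)))
    {k l : ℕ} (hkl : k + 2 * l ≤ n) {B : Fin k → Set ℝ} {C : Fin l → Set ℂ}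
    (hB : ∀ i, MeasurableSet (B i)) (hC : ∀ j, MeasurableSet (C j))
    (hCU : ∀ j, C j ⊆ {z : ℂ | 0 < z.im}) (hBd : Pairwise fun i i' => Disjoint (B i) (B i'))
    (hCd : Pairwise fun j j' => Disjoint (C j) (C j')) :
    ∫⁻ ω, ((∏ i, zeroMeasure (fun q => ξ q ω) (Complex.ofReal '' B i)) *
      ∏ j, zeroMeasure (fun q => ξ q ω) (C j)) ∂P =
    ∫⁻ p in Set.univ.pi B ×ˢ Set.univ.pi C,
      cofactorIntegral (n - (k + l + l) + 1) (jointDensity f) p.1 p.2 := by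
  have hBC (i) := measurableSet_ofReal_image (hB i)
  have hR : Measurable fun a : Fin (n + 1) → ℝ =>
      (∏ i, rootCount a (Complex.ofReal '' B i)) * ∏ j, rootCount a (C j) :=
    (Finset.measurable_fun_prod _ fun i _ => measurable_rootCount (hBC i)).mul
      (Finset.measurable_fun_prod _ fun i _ => measurable_rootCount (hC _))
  simp only [fun i ω => zeroMeasure_apply (fun q => ξ q ω) (hBC i),
    fun j ω => zeroMeasure_apply (fun q => ξ q ω) (hC j)]
  rw [lintegral_comp_coefficients hξ hindep hf hdens hR,
    lintegral_mul_prod_rootCount hB hBd hC hCU hCd (D := n - (k + l + l) + 1) (by lia)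
      (measurable_jointDensity hf), Measure.volume_eq_prod, ← Measure.prod_restrict,
    lintegral_prod_symm _ (measurable_cofactorIntegral k l _
      (measurable_jointDensity hf)).aemeasurable]

/-- The coefficients have a joint density, so the polynomial is almost surely nonzero, and each
count is then at most the number `n + 1` of coefficients. -/
theorem lintegral_prod_zeroMeasure_lt_top (hξ : ∀ i, Measurable (ξ i)) (hindep : iIndepFun ξ P)
    (hf : ∀ i, Measurable (f i))
    (hdens : ∀ i, P.map (ξ i) = volume.withDensity (fun t => ENNReal.ofReal (f i t)))
    {k l : ℕ} {B : Fin k → Set ℝ} {C : Fin l → Set ℂ} (hB : ∀ i, MeasurableSet (B i))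
    (hC : ∀ j, MeasurableSet (C j)) :
    ∫⁻ ω, ((∏ i, zeroMeasure (fun q => ξ q ω) (Complex.ofReal '' B i)) *
      ∏ j, zeroMeasure (fun q => ξ q ω) (C j)) ∂P < ⊤ := by
  calc _ ≤ ∫⁻ _, ((n + 1 : ℕ) : ENNReal) ^ k * ((n + 1 : ℕ) : ENNReal) ^ l ∂P := by
        refine lintegral_mono_ae ?_
        filter_upwards [ae_coefficients_ne_zero hξ hindep hf hdens] with ω hω
        simp only [zeroMeasure_apply (fun q => ξ q ω) (measurableSet_ofReal_image (hB _)),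
          zeroMeasure_apply (fun q => ξ q ω) (hC _)]
        refine mul_le_mul' ?_ ?_
        · exact (Finset.prod_le_pow_card _ _ _ fun i _ => rootCount_le hω _).trans (by simp)
        · exact (Finset.prod_le_pow_card _ _ _ fun i _ => rootCount_le hω _).trans (by simp)
    _ < ⊤ := by
        rw [lintegral_const, measure_univ, mul_one]
        exact ENNReal.mul_lt_top (ENNReal.pow_lt_top (ENNReal.natCast_lt_top _))
          (ENNReal.pow_lt_top (ENNReal.natCast_lt_top _))

theorem isMixedCorrelation_rho (hξ : ∀ i, Measurable (ξ i)) (hindep : iIndepFun ξ P)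
    (hf : ∀ i, Measurable (f i)) (hf0 : ∀ i t, 0 ≤ f i t)
    (hdens : ∀ i, P.map (ξ i) = volume.withDensity (fun t => ENNReal.ofReal (f i t)))
    {k l : ℕ} (hkl : k + 2 * l ≤ n) :
    IsMixedCorrelation P ξ k l (fun x z => 2 ^ l * rho f (conjTuple x z)) where
  nonneg p _ := by
    simp only [← toReal_cofactorIntegral_jointDensity hf hf0]
    exact ENNReal.toReal_nonneg
  correlation B C hB hC hCU hBd hCd := by
    have heq := lintegral_prod_zeroMeasure hξ hindep hf hdens hkl hB hC hCU hBd hCd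
    have hlt := lintegral_prod_zeroMeasure_lt_top hξ hindep hf hdens hB hC
    have hmeas : Measurable fun ω =>
        (∏ i, zeroMeasure (fun q => ξ q ω) (Complex.ofReal '' B i)) *
          ∏ j, zeroMeasure (fun q => ξ q ω) (C j) := by
      have hBC (i) := measurableSet_ofReal_image (hB i)
      simp only [fun i ω => zeroMeasure_apply (fun q => ξ q ω) (hBC i),
        fun j ω => zeroMeasure_apply (fun q => ξ q ω) (hC j)]
      exact (Finset.measurable_fun_prod _ fun i _ => (measurable_rootCount (hBC i)).comp
        (measurable_pi_lambda _ hξ)).mul (Finset.measurable_fun_prod _ fun j _ =>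
          (measurable_rootCount (hC j)).comp (measurable_pi_lambda _ hξ))
    have hmeas' : Measurable fun p : (Fin k → ℝ) × (Fin l → ℂ) =>
        cofactorIntegral (n - (k + l + l) + 1) (jointDensity f) p.1 p.2 :=
      measurable_cofactorIntegral k l _ (measurable_jointDensity hf)
    have hleft (ω : Ω) : (∏ i, (zeroMeasure fun q => ξ q ω).real (Complex.ofReal '' B i)) *
        ∏ j, (zeroMeasure fun q => ξ q ω).real (C j) =
        ((∏ i, zeroMeasure (fun q => ξ q ω) (Complex.ofReal '' B i)) *
          ∏ j, zeroMeasure (fun q => ξ q ω) (C j)).toReal := by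
      rw [ENNReal.toReal_mul, ENNReal.toReal_prod, ENNReal.toReal_prod]
      rfl
    simp only [hleft, ← toReal_cofactorIntegral_jointDensity hf hf0]
    refine ⟨integrable_toReal_of_lintegral_ne_top hmeas.aemeasurable hlt.ne,
      integrable_toReal_of_lintegral_ne_top hmeas'.aemeasurable (heq ▸ hlt.ne), ?_⟩
    rw [integral_toReal hmeas.aemeasurable (ae_lt_top hmeas hlt.ne),
      integral_toReal hmeas'.aemeasurable (ae_lt_top hmeas' (heq ▸ hlt.ne)), heq]

/-- The cofactor integral has finite integral over each product of disjoint sets, hence is finite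
almost everywhere there; dividing by the Vandermonde factor, almost everywhere nonzero, gives
convergence. -/
theorem ae_integrable_rhoIntegrand (hξ : ∀ i, Measurable (ξ i)) (hindep : iIndepFun ξ P)
    (hf : ∀ i, Measurable (f i)) (hf0 : ∀ i t, 0 ≤ f i t)
    (hdens : ∀ i, P.map (ξ i) = volume.withDensity (fun t => ENNReal.ofReal (f i t)))
    {k l : ℕ} (hkl : k + 2 * l ≤ n) :
    ∀ᵐ p ∂(volume.restrict (upperConfig k l)),
      Integrable (rhoIntegrand f (conjTuple p.1 p.2)) volume := by
  have hfin : ∀ᵐ p ∂(volume.restrict (upperConfig k l)),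
      cofactorIntegral (n - (k + l + l) + 1) (jointDensity f) p.1 p.2 < ⊤ := by
    refine ae_upperConfig_of_ae_pi fun B C hB hC hCU hBd hCd => ?_
    have heq := lintegral_prod_zeroMeasure hξ hindep hf hdens hkl hB hC hCU hBd hCd
    have hlt := lintegral_prod_zeroMeasure_lt_top hξ hindep hf hdens hB hC
    exact ae_lt_top (measurable_cofactorIntegral k l _ (measurable_jointDensity hf))
      (heq ▸ hlt.ne)
  filter_upwards [hfin, ae_restrict_of_ae (ae_injective_prod k l),
    ae_restrict_mem (measurableSet_upperConfig k l)] with p hp hinj hpU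
  exact integrable_rhoIntegrand hf hf0
    (absVandermonde_conjTuple_ne_zero hinj.1 hinj.2 hpU) hp

end Main

end

theorem theorem1 {Ω : Type*} [MeasurableSpace Ω] (P : Measure Ω) [IsProbabilityMeasure P]
    (n : ℕ) (ξ : Fin (n + 1) → Ω → ℝ) (f : Fin (n + 1) → ℝ → ℝ)
    (hξ : ∀ i, Measurable (ξ i)) (hindep : iIndepFun ξ P)
    (hf : ∀ i, Measurable (f i)) (hf0 : ∀ i t, 0 ≤ f i t)
    (hdens : ∀ i, P.map (ξ i) = volume.withDensity (fun t => ENNReal.ofReal (f i t)))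
    (k l : ℕ) (hkl : k + 2 * l ≤ n) :
    -- the integral defining `ρ_{k+2l}(x, z, z̄)` converges for almost all `(x, z)`
    (∀ᵐ p ∂(volume.restrict (upperConfig k l)),
      Integrable (rhoIntegrand f (conjTuple p.1 p.2)) volume) ∧
    -- `2^l ρ_{k+2l}(x, z, z̄)` is a mixed `(k,l)`-correlation function
    IsMixedCorrelation P ξ k l (fun x z => 2 ^ l * rho f (conjTuple x z)) ∧
    -- every mixed `(k,l)`-correlation function equals it (as always, up to a Lebesgue null set)
    (∀ r : (Fin k → ℝ) → (Fin l → ℂ) → ℝ, IsMixedCorrelation P ξ k l r →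
      ∀ᵐ p ∂(volume.restrict (upperConfig k l)),
        r p.1 p.2 = 2 ^ l * rho f (conjTuple p.1 p.2)) := by
  have hcorr := isMixedCorrelation_rho hξ hindep hf hf0 hdens hkl
  exact ⟨ae_integrable_rhoIntegrand hξ hindep hf hf0 hdens hkl, hcorr,
    fun r hr => hr.ae_eq hcorr⟩
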